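/- Let $k$ be a field, $n\ge 4$, and let $\mathcal A=\{d_1,\ldots,d_n\}$ be a set of $n$ positive integers with $\gcd(\mathcal A)=1$ which is a minimal set of generators of the semigroup $\mathbb N\mathcal A=\sum_{i}\mathbb N d_i$, i.e. no $d_i$ lies in $\sum_{j\ne i}\mathbb N d_j$. Let $I_{\mathcal A}\subset k[x_1,\ldots,x_n]$ be the kernel of the $k$-algebra homomorphism $k[x_1,\ldots,x_n]\to k[t]$, $x_i\mapsto t^{d_i}$; it is called a complete intersection if its minimal number of generators equals its height. Suppose that $\mathcal A\setminus\{d_n\}$ is a generalized arithmetic sequence, i.e. there is a positive integer $h$ such that $h d_1, d_2,\ldots,d_{n-1}$ is an increasing arithmetic sequence. Then $I_{\mathcal A}$ is a complete intersection if and only if $n=4$ and at least one of the following holds: 1. $d_1/\gcd\{d_1,d_2\}$ is even and $\gcd\{d_1,d_2\}\,d_4\in\mathbb N\{d_1,d_2,d_3\}=\mathbb N d_1+\mathbb N d_2+\mathbb N d_3$; 2. $d_1$ and $d_4$ are even and $\mathcal C_{red}=\emptyset$, where $\mathcal C=\{d_1,d_3,d_4\}$. Here, for a finite set $\mathcal B$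 of positive integers, $\mathcal B_{red}$ denotes the set obtained from $\mathcal B$ by applying the following steps iteratively until it is empty or each of its elements $b$ satisfies $b\in\sum_{a\in\mathcal B\setminus\{b\}}\mathbb Z a\setminus\sum_{a\in\mathcal B\setminus\{b\}}\mathbb N a$ (where $\mathcal B$ denotes the current set): remove an element $b$ with $b\notin\sum_{a\in\mathcal B\setminus\{b\}}\mathbb Q a$; remove an element $b$ with $b\in\sum_{a\in\mathcal B\setminus\{b\}}\mathbb N a$; replace an element $b\in\sum_{a\in\mathcal B\setminus\{b\}}\mathbb Q a$ by $c\,b$, where $c$ is the least positive integer with $c\,b\in\sum_{a\in\mathcal B\setminus\{b\}}\mathbb Z a$. (The resulting set does not depend on the choices made.) -/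

import Mathlib

/-- The toric ideal `I_A` of a family `d` of positive integers: the kernel of the `k`-algebra
homomorphism `k[x_i : i ∈ ι] → k[t]`, `x_i ↦ t ^ (d i)`. -/
noncomputable def toricIdeal (k : Type*) [Field k] {ι : Type*} (d : ι → ℕ) :
    Ideal (MvPolynomial ι k) :=
  RingHom.ker (MvPolynomial.aeval (fun i => (Polynomial.X : Polynomial k) ^ d i) :
    MvPolynomial ι k →ₐ[k] Polynomial k)

/-- An ideal (of a Noetherian ring) is a complete intersection if its minimal number of
generators equals its height. -/
def IsCompleteIntersection {R : Type*} [CommRing R] (I : Ideal R) : Prop :=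
  ((Submodule.spanFinrank I : ℕ) : ℕ∞) = I.height

/-- `d 1, …, d m` is a generalized arithmetic sequence: for some positive integer `h`,
the sequence `h * d 1, d 2, …, d m` is an increasing arithmetic sequence
(with common difference `e > 0`). -/
def IsGenArithSeq (d : ℕ → ℕ) (m : ℕ) : Prop :=
  ∃ h e : ℕ, 0 < h ∧ 0 < e ∧ ∀ i ∈ Finset.Icc 2 m, d i = h * d 1 + (i - 1) * e

/-- One step of the reduction of a finite set `B` of positive integers. -/
inductive RedStep : Finset ℕ → Finset ℕ → Prop
  /-- Remove an element which is not a rational combination of the other ones. -/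
  | removeRat (B : Finset ℕ) (b : ℕ) (hb : b ∈ B)
      (h : (b : ℚ) ∉ Submodule.span ℚ ((fun a : ℕ => (a : ℚ)) '' (B.erase b : Finset ℕ))) :
      RedStep B (B.erase b)
  /-- Remove an element which lies in the semigroup spanned by the other ones. -/
  | removeNat (B : Finset ℕ) (b : ℕ) (hb : b ∈ B)
      (h : b ∈ AddSubmonoid.closure ((B.erase b : Finset ℕ) : Set ℕ)) :
      RedStep B (B.erase b)
  /-- Replace an element `b` by `c * b`, where `c` is the least positive integer such that
  `c * b` lies in the subgroup of `ℤ` spanned by the other elements. -/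
  | scale (B : Finset ℕ) (b : ℕ) (hb : b ∈ B) (c : ℕ)
      (h : IsLeast {c : ℕ | 0 < c ∧ ((c * b : ℕ) : ℤ) ∈
        AddSubgroup.closure ((fun a : ℕ => (a : ℤ)) '' (B.erase b : Finset ℕ))} c) :
      RedStep B (insert (c * b) (B.erase b))

/-- `R = B_red`: `R` is obtained from `B` by iterating reduction steps, and every element of
`R` lies in the subgroup, but not in the semigroup, spanned by the other elements of `R`. -/
def IsReduction (B R : Finset ℕ) : Prop :=
  Relation.ReflTransGen RedStep B R ∧
    ∀ b ∈ R,
      (b : ℤ) ∈ AddSubgroup.closure ((fun a : ℕ => (a : ℤ)) '' (R.erase b : Finset ℕ)) ∧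
      b ∉ AddSubmonoid.closure ((R.erase b : Finset ℕ) : Set ℕ)

/-! Let I be the toric ideal, a prime of height n - 1 (`height_toricIdeal`), and m the ideal of the
variables. Necessity rests on an exchange principle drawn from Nakayama's lemma and Krull's height
theorem (`subset_of_le_span_sup_mul`): if at most height-of-I elements of m generate I modulo mI, in
the sense that I is contained in their span plus mI, then they all lie in I. No variable lies in I.
Hence, in a complete intersection, r ≥ 1 of the generating binomials can never be traded for at most
r variables such that both monomials of each traded binomial are divisible by one of these
variables.

The arithmetic sequence supplies quadrics. As the generators of the semigroup are minimal, elements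
of I have no terms of degree at most one, so coefficients in degree two vanish on mI and detect
quadrics among minimal generators (`exists_binomial_extension`). If n ≥ 5, the quadrics x₂² - x₁^h
x₃, x₂x₃ - x₁^h x₄ and x₃² - x₂x₄ could be traded for x₂, x₃, x₄, a contradiction. If n = 4, the
first of them is still a generator; together with two more binomials it spans the lattice of
relations (`map_eq_of_toricIdeal_le_span_sup_mul`). The forbidden exchanges leave few possible
supports for these two (`IsMixedDominating.pattern`), and expanding well-chosen relations in this
basis gives the parities and the least multipliers of the two conditions
(`IsMixedDominating.gluing`).

Conversely, if the generators can be glued on one at a time, each through its least multiplier, then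
three binomials generate I (`isCompleteIntersection_of_gluing`). Condition 1 glues d₄ to the rest
with multiplier gcd(d₁, d₂), and d₂ to d₁, d₃ with multiplier 2. Condition 2 glues d₂ to the rest
with multiplier 2; the empty reduction then provides a gluing of the other three
(`exists_of_reflTransGen_redStep_empty`). -/

open MvPolynomial

/-! ### Exchange of generators and extension to generators modulo m I. -/

section Ideals

/-- If a prime ideal `I` is generated, modulo `m * I`, by at most `I.height` elements of a proper
prime `m`, then these elements belong to `I`. -/
theorem subset_of_le_span_sup_mul {R : Type*} [CommRing R] [IsNoetherianRing R] {I m : Ideal R}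
    [I.IsPrime] [hm : m.IsPrime] {G : Finset R}
    (hcard : (G.card : ℕ∞) ≤ I.height) (hGm : (G : Set R) ⊆ m)
    (hI : I ≤ Ideal.span G ⊔ m * I) : (G : Set R) ⊆ I := by
  obtain ⟨Q, hQ, hQm⟩ := Ideal.exists_minimalPrimes_le (Ideal.span_le.2 hGm)
  have := hQ.1.1
  have hGQ : Ideal.span G ≤ Q := hQ.1.2
  -- Nakayama gives r ≡ 1 mod m with r I inside the span of G. Since Q lies in m, r is outside Q, so
  -- Q contains I; Krull's height theorem then forces I = Q.
  obtain ⟨r, hr, hrI⟩ := Submodule.exists_sub_one_mem_and_smul_le_of_fg_of_le_sup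
    (IsNoetherian.noetherian I) le_rfl (by simpa using hI)
  have hrQ : r ∉ Q := fun h => by
    have h1 : r - (r - 1) ∈ m := m.sub_mem (hQm h) hr
    exact hm.ne_top ((Ideal.eq_top_iff_one m).2 (by simpa using h1))
  have hIQ : I ≤ Q := fun x hx => by
    have h1 : r * x ∈ Q := hGQ (hrI (Submodule.smul_mem_pointwise_smul x r I hx))
    exact (Ideal.IsPrime.mem_or_mem ‹_› h1).resolve_left hrQ
  have hQh : Q.height ≤ I.height :=
    (Ideal.height_le_card_of_mem_minimalPrimes_span_finset hQ).trans hcard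
  have hIeq : I = Q := by
    by_contra hne
    have h1 := Ideal.height_strict_mono_of_isPrime_of_isPrime (lt_of_le_of_ne hIQ hne)
    exact absurd h1 (not_lt.2 hQh)
  rw [hIeq]
  exact Ideal.span_le.1 hGQ

/-- Let `m` be an ideal of a `k`-algebra `R = k + m`. Any set of elements of the ideal `I` which is
separated by functionals vanishing on `m * I` can be completed, by elements of a set generating
`I / m I` over `k`, to a set generating `I` modulo `m * I`, with no more elements than a given
finite set of generators of `I`. -/
theorem exists_extension_le_span_sup_mul {k R : Type*} [Field k] [CommRing R] [Algebra k R]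
    {I m : Ideal R} (hm : ∀ a : R, ∃ c : k, a - algebraMap k R c ∈ m)
    (F : Finset R) (hF : Ideal.span F = I) {Q T : Set R} (hQT : Q ⊆ T) (hTI : T ⊆ I)
    (hIT : ∀ x ∈ I, x ∈ Submodule.span k T ⊔ (m * I).restrictScalars k)
    (hQ : ∀ q ∈ Q, ∃ φ : R →ₗ[k] k, (∀ x ∈ m * I, φ x = 0) ∧ φ q ≠ 0 ∧
      ∀ q' ∈ Q, q' ≠ q → φ q' = 0) :
    ∃ B : Finset R, Q ⊆ B ∧ (B : Set R) ⊆ T ∧ B.card ≤ F.card ∧ I ≤ Ideal.span B ⊔ m * I := by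
  classical
  set W : Submodule k R := (m * I).restrictScalars k with hW
  have hind : LinearIndepOn k W.mkQ Q := by
    rw [linearIndepOn_iff]
    intro l hl h0
    ext q
    by_cases hq : q ∈ Q
    · obtain ⟨φ, hφ, hφq, hφ'⟩ := hQ q hq
      have h1 : W.mkQ (Finsupp.linearCombination k id l) = 0 := by
        rw [Finsupp.apply_linearCombination]; exact h0
      have h2 : Finsupp.linearCombination k id l ∈ m * I := by
        rwa [Submodule.mkQ_apply, Submodule.Quotient.mk_eq_zero] at h1
      have h3 := hφ _ h2
      rw [Finsupp.apply_linearCombination, Finsupp.linearCombination_apply, Finsupp.sum,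
        Finset.sum_eq_single q] at h3
      · simpa [hφq] using h3
      · intro q' hq' hne
        simp [hφ' q' (hl hq') hne]
      · intro hq'
        simp [Finsupp.notMem_support_iff.1 hq']
    · exact Finsupp.notMem_support_iff.1 fun h => hq (hl h)
  obtain ⟨b, hbT, hQb, hTb, hb⟩ := exists_linearIndepOn_extension hind hQT
  -- Since R = k + m, generators of I over R already span I / m I over k; this bounds the size of
  -- the extension.
  have hspan : ∀ x ∈ I, W.mkQ x ∈ Submodule.span k (W.mkQ '' (F : Set R)) := by
    intro x hx
    rw [← hF] at hx
    refine Submodule.span_induction (p := fun x _ => W.mkQ x ∈ _) ?_ ?_ ?_ ?_ hx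
    · exact fun x hx => Submodule.subset_span ⟨x, hx, rfl⟩
    · simp
    · intro x y _ _ hx hy
      rw [map_add]; exact Submodule.add_mem _ hx hy
    · intro a x hx h
      obtain ⟨c, hc⟩ := hm a
      have h1 : W.mkQ (a • x) = c • W.mkQ x := by
        rw [← map_smul, ← sub_eq_zero, ← map_sub, Submodule.mkQ_apply,
          Submodule.Quotient.mk_eq_zero]
        have h2 := Ideal.mul_mem_mul hc (hF ▸ hx : x ∈ I)
        rwa [sub_mul, ← Algebra.smul_def] at h2
      rw [h1]; exact Submodule.smul_mem _ _ h
  have hrange : Set.range (fun x : b => W.mkQ x) ⊆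
      Submodule.span k ((F.image W.mkQ : Finset (R ⧸ W)) : Set (R ⧸ W)) := by
    rintro _ ⟨x, rfl⟩
    rw [Finset.coe_image]
    exact hspan _ (hTI (hbT x.2))
  have hfin : Finite b := LinearIndependent.finite_of_le_span_finite _ hb _ hrange
  have := Fintype.ofFinite b
  have hcard := linearIndependent_le_span_aux' _ hb _ hrange
  refine ⟨b.toFinset, by simpa using hQb, by simpa using hbT, ?_, ?_⟩
  · rw [Set.toFinset_card]
    refine hcard.trans ?_
    exact (Fintype.card_coe _).trans_le Finset.card_image_le
  · intro x hx
    obtain ⟨s, hs, z, hz, rfl⟩ := Submodule.mem_sup.1 (hIT x hx)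
    have h1 : W.mkQ s ∈ Submodule.map W.mkQ (Submodule.span k b) := by
      rw [Submodule.map_span]
      have : W.mkQ s ∈ Submodule.map W.mkQ (Submodule.span k T) := ⟨s, hs, rfl⟩
      rw [Submodule.map_span] at this
      exact Submodule.span_le.2 hTb this
    obtain ⟨s', hs', h2⟩ := h1
    rw [← sub_eq_zero, ← map_sub, Submodule.mkQ_apply, Submodule.Quotient.mk_eq_zero] at h2
    have h3 : s' ∈ Ideal.span (b.toFinset : Set R) := by
      rw [Set.coe_toFinset]
      exact Submodule.span_subset_span k R b hs'
    have : s + z = s' + (z - (s' - s)) := by ring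
    rw [this]
    exact Submodule.add_mem_sup h3 (Submodule.sub_mem _ hz h2)

end Ideals

/-! ### Binomials in toric ideals and terms of low degree. -/

section Toric

variable {k : Type*} [Field k] {ι : Type*}

/-- The binomial `x ^ u - x ^ v`. -/
noncomputable def binomial (k : Type*) [Field k] {ι : Type*} (u v : ι →₀ ℕ) : MvPolynomial ι k :=
  monomial u 1 - monomial v 1

instance toricIdeal_isPrime (w : ι → ℕ) : (toricIdeal k w).IsPrime :=
  RingHom.ker_isPrime _

theorem aeval_X_pow_monomial (w : ι → ℕ) (u : ι →₀ ℕ) (c : k) :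
    aeval (fun i => (Polynomial.X : Polynomial k) ^ w i) (monomial u c) =
      Polynomial.monomial (Finsupp.weight w u) c := by
  rw [aeval_monomial, Finsupp.weight_apply, ← Polynomial.C_mul_X_pow_eq_monomial]
  simp only [← pow_mul, Finsupp.prod, Finset.prod_pow_eq_pow_sum, Finsupp.sum, smul_eq_mul]
  congr 2
  exact Finset.sum_congr rfl fun _ _ => mul_comm _ _

theorem mem_toricIdeal (w : ι → ℕ) (f : MvPolynomial ι k) :
    f ∈ toricIdeal k w ↔ aeval (fun i => (Polynomial.X : Polynomial k) ^ w i) f = 0 :=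
  RingHom.mem_ker

theorem binomial_mem_toricIdeal {w : ι → ℕ} {u v : ι →₀ ℕ}
    (h : Finsupp.weight w u = Finsupp.weight w v) : binomial k u v ∈ toricIdeal k w := by
  rw [mem_toricIdeal, binomial, map_sub, aeval_X_pow_monomial, aeval_X_pow_monomial, h, sub_self]

theorem X_notMem_toricIdeal (w : ι → ℕ) (i : ι) : (X i : MvPolynomial ι k) ∉ toricIdeal k w := by
  rw [mem_toricIdeal, aeval_X]
  exact pow_ne_zero _ Polynomial.X_ne_zero

/-- Choosing one monomial in each attained degree gives a linear map `Ψ` back from k[t]. Every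
polynomial differs from `Ψ` of its image by a combination of binomials, and f has image zero. -/
theorem toricIdeal_le_span_binomial (w : ι → ℕ) {f : MvPolynomial ι k} (hf : f ∈ toricIdeal k w) :
    f ∈ Submodule.span k {g | ∃ u v : ι →₀ ℕ,
      Finsupp.weight w u = Finsupp.weight w v ∧ g = binomial k u v} := by
  classical
  set S : Submodule k (MvPolynomial ι k) := Submodule.span k {g | ∃ u v : ι →₀ ℕ,
      Finsupp.weight w u = Finsupp.weight w v ∧ g = binomial k u v} with hS
  let rep : ℕ → MvPolynomial ι k := fun b =>
    if h : ∃ u : ι →₀ ℕ, Finsupp.weight w u = b then monomial h.choose 1 else 0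
  let Ψ : Polynomial k →ₗ[k] MvPolynomial ι k := (Polynomial.basisMonomials k).constr k rep
  have key : ∀ g : MvPolynomial ι k,
      g - Ψ (aeval (fun i => (Polynomial.X : Polynomial k) ^ w i) g) ∈ S := by
    intro g
    induction g using MvPolynomial.induction_on' with
    | monomial u c =>
      have hu : ∃ v : ι →₀ ℕ, Finsupp.weight w v = Finsupp.weight w u := ⟨u, rfl⟩
      have h1 : Ψ (Polynomial.monomial (Finsupp.weight w u) c) = c • monomial hu.choose 1 := by
        have h2 : Polynomial.monomial (Finsupp.weight w u) c =
            c • Polynomial.basisMonomials k (Finsupp.weight w u) := by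
          simp [Polynomial.smul_monomial]
        rw [h2, map_smul, Module.Basis.constr_basis]
        simp only [rep, dif_pos hu]
      have h3 : (monomial u c : MvPolynomial ι k) = c • monomial u 1 := by
        simp [smul_monomial]
      rw [aeval_X_pow_monomial, h1, h3, ← smul_sub]
      exact S.smul_mem _ (Submodule.subset_span ⟨u, _, hu.choose_spec.symm, rfl⟩)
    | add p q hp hq =>
      rw [map_add, map_add, add_sub_add_comm]
      exact S.add_mem hp hq
  have := key f
  rwa [(mem_toricIdeal w f).1 hf, map_zero, sub_zero] at this

theorem toricIdeal_le_of_binomial_mem {w : ι → ℕ} {J : Ideal (MvPolynomial ι k)}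
    (h : ∀ u v : ι →₀ ℕ, Finsupp.weight w u = Finsupp.weight w v → binomial k u v ∈ J) :
    toricIdeal k w ≤ J := by
  intro f hf
  have h1 := toricIdeal_le_span_binomial w hf
  have h2 : Submodule.span k {g | ∃ u v : ι →₀ ℕ,
      Finsupp.weight w u = Finsupp.weight w v ∧ g = binomial k u v} ≤ J.restrictScalars k := by
    rw [Submodule.span_le]
    rintro _ ⟨u, v, huv, rfl⟩
    exact h u v huv
  exact h2 h1

theorem binomial_add (p u v : ι →₀ ℕ) :
    binomial k (p + u) (p + v) = monomial p 1 * binomial k u v := by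
  simp [binomial, mul_sub, monomial_mul]

theorem weight_eq_zero {w : ι → ℕ} (hw : ∀ i, 0 < w i) {u : ι →₀ ℕ}
    (hu : Finsupp.weight w u = 0) : u = 0 := by
  rw [Finsupp.weight_apply, Finsupp.sum, Finset.sum_eq_zero_iff] at hu
  ext i
  by_contra h
  have := hu i (Finsupp.mem_support_iff.2 h)
  simp only [smul_eq_mul, mul_eq_zero] at this
  exact this.elim h (hw i).ne'

/-- The ideal generated by the variables. -/
noncomputable def irrelevant (k : Type*) [Field k] (ι : Type*) : Ideal (MvPolynomial ι k) :=
  RingHom.ker (constantCoeff : MvPolynomial ι k →+* k)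

theorem mem_irrelevant {f : MvPolynomial ι k} : f ∈ irrelevant k ι ↔ constantCoeff f = 0 :=
  RingHom.mem_ker

instance irrelevant_isPrime : (irrelevant k ι).IsPrime := RingHom.ker_isPrime _

theorem X_mem_irrelevant (i : ι) : (X i : MvPolynomial ι k) ∈ irrelevant k ι := by
  simp [mem_irrelevant]

theorem monomial_mem_irrelevant {u : ι →₀ ℕ} (hu : u ≠ 0) (c : k) :
    (monomial u c : MvPolynomial ι k) ∈ irrelevant k ι := by
  classical
  rw [mem_irrelevant, constantCoeff_eq, coeff_monomial, if_neg hu]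

theorem exists_sub_algebraMap_mem_irrelevant (f : MvPolynomial ι k) :
    ∃ c : k, f - algebraMap k _ c ∈ irrelevant k ι :=
  ⟨constantCoeff f, by simp [mem_irrelevant, algebraMap_eq]⟩

theorem toricIdeal_le_irrelevant {w : ι → ℕ} (hw : ∀ i, 0 < w i) :
    toricIdeal k w ≤ irrelevant k ι := by
  refine toricIdeal_le_of_binomial_mem fun u v h => ?_
  by_cases hu : u = 0
  · have hv : v = 0 := weight_eq_zero hw (by rw [← h, hu, map_zero])
    simp [binomial, hu, hv]
  · have hv : v ≠ 0 := fun hv => hu (weight_eq_zero hw (by rw [h, hv, map_zero]))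
    exact Ideal.sub_mem _ (monomial_mem_irrelevant hu 1) (monomial_mem_irrelevant hv 1)

/-- If no weight is a combination of other weights, no monomial of degree at most one occurs in an
element of the toric ideal. -/
theorem coeff_eq_zero_of_mem_toricIdeal {w : ι → ℕ} (hw : ∀ i, 0 < w i)
    (hmin : ∀ i, ∀ u : ι →₀ ℕ, Finsupp.weight w u = w i → u = Finsupp.single i 1)
    {f : MvPolynomial ι k} (hf : f ∈ toricIdeal k w) {u : ι →₀ ℕ} (hu : u.degree ≤ 1) :
    coeff u f = 0 := by
  classical
  have huniq : ∀ v : ι →₀ ℕ, Finsupp.weight w v = Finsupp.weight w u → v = u := by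
    intro v hv
    rcases Nat.le_one_iff_eq_zero_or_eq_one.1 hu with h | h
    · rw [Finsupp.degree_eq_zero_iff] at h
      subst h
      exact weight_eq_zero hw (by rw [hv, map_zero])
    · obtain ⟨i, rfl⟩ : u ∈ Set.range fun i => Finsupp.single i 1 := by
        rw [Finsupp.range_single_one]; exact h
      exact hmin i v (by rw [hv, Finsupp.weight_single]; simp)
  have key : ∀ g : MvPolynomial ι k, coeff u g =
      (aeval (fun i => (Polynomial.X : Polynomial k) ^ w i) g).coeff (Finsupp.weight w u) := by
    intro g
    induction g using MvPolynomial.induction_on' with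
    | monomial v c =>
      rw [aeval_X_pow_monomial, coeff_monomial, Polynomial.coeff_monomial]
      refine if_congr ⟨fun h => by rw [h], huniq v⟩ rfl rfl
    | add p q hp hq => rw [coeff_add, map_add, Polynomial.coeff_add, hp, hq]
  rw [key, (mem_toricIdeal w f).1 hf, Polynomial.coeff_zero]

/-- A factor from the toric ideal starts in degree two, so a term of degree two in the product would
need the constant term of the other factor, which is zero. -/
theorem coeff_eq_zero_of_mem_irrelevant_mul {w : ι → ℕ} (hw : ∀ i, 0 < w i)
    (hmin : ∀ i, ∀ u : ι →₀ ℕ, Finsupp.weight w u = w i → u = Finsupp.single i 1)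
    {f : MvPolynomial ι k} (hf : f ∈ irrelevant k ι * toricIdeal k w) {u : ι →₀ ℕ}
    (hu : u.degree = 2) : coeff u f = 0 := by
  classical
  refine Submodule.mul_induction_on hf (fun a ha g hg => ?_) (fun f g hf hg => ?_)
  · rw [coeff_mul]
    refine Finset.sum_eq_zero fun p hp => ?_
    rw [Finset.HasAntidiagonal.mem_antidiagonal] at hp
    have hdeg : p.1.degree + p.2.degree = 2 := by rw [← map_add, hp, hu]
    by_cases h : p.2.degree ≤ 1
    · rw [coeff_eq_zero_of_mem_toricIdeal hw hmin hg h, mul_zero]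
    · have h0 : p.1 = 0 := (Finsupp.degree_eq_zero_iff _).1 (by omega)
      rw [h0, ← constantCoeff_eq, mem_irrelevant.1 ha, zero_mul]
  · rw [coeff_add, hf, hg, add_zero]

end Toric

/-! ### The height of a toric ideal. -/

section Height

variable {k : Type*} [Field k] {ι : Type*}

/-- The homomorphism which sends `x_i` to `t ^ (w i)` for `i ∈ S` and fixes the other variables. -/
noncomputable def partialToricHom (k : Type*) [Field k] {ι : Type*} [DecidableEq ι] (w : ι → ℕ)
    (S : Finset ι) : MvPolynomial ι k →ₐ[k] MvPolynomial (Option ι) k :=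
  aeval fun i => if i ∈ S then X none ^ w i else X (some i)

/-- Enlarging S one index at a time gives a chain of prime kernels, strict from the second index on;
hence the shift by one. -/
theorem card_le_height_ker_partialToricHom [DecidableEq ι] (w : ι → ℕ)
    (hw : ∀ i, 0 < w i) (S : Finset ι) :
    (S.card : ℕ∞) ≤ (RingHom.ker (partialToricHom k w S)).height + 1 := by
  induction S using Finset.induction_on with
  | empty => simp
  | insert i S hi ih =>
    rw [Finset.card_insert_of_notMem hi, Nat.cast_add, Nat.cast_one]
    rcases S.eq_empty_or_nonempty with rfl | ⟨j, hj⟩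
    · simp
    have hle : RingHom.ker (partialToricHom k w S) ≤
        RingHom.ker (partialToricHom k w (insert i S)) := by
      let θ : MvPolynomial (Option ι) k →ₐ[k] MvPolynomial (Option ι) k :=
        aeval fun o => if o = some i then X none ^ w i else X o
      have hθ : θ.comp (partialToricHom k w S) = partialToricHom k w (insert i S) := by
        ext1 l
        by_cases hl : l ∈ S
        · simp [θ, partialToricHom, hl]
        · by_cases hli : l = i
          · subst hli; simp [θ, partialToricHom, hl]
          · simp [θ, partialToricHom, hl, hli]
      intro f hf
      rw [RingHom.mem_ker] at hf ⊢
      rw [← hθ, AlgHom.comp_apply, hf, map_zero]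
    have hlt : RingHom.ker (partialToricHom k w S) <
        RingHom.ker (partialToricHom k w (insert i S)) := by
      refine lt_of_le_of_ne hle fun heq => ?_
      have h1 : (X i ^ w j - X j ^ w i : MvPolynomial ι k) ∈
          RingHom.ker (partialToricHom k w (insert i S)) := by
        simp [RingHom.mem_ker, partialToricHom, hj, ← pow_mul, mul_comm]
      rw [← heq, RingHom.mem_ker] at h1
      have h2 : (X (some i) ^ w j - (X none ^ w j) ^ w i : MvPolynomial (Option ι) k) = 0 := by
        simpa [partialToricHom, hj, hi] using h1
      -- Setting t = 0 and all other variables to 1 turns the left-hand side into 1.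
      have h3 := congrArg (aeval fun o : Option ι => if o = none then (0 : k) else 1) h2
      simp [(hw i).ne', (hw j).ne'] at h3
    have h1 : (RingHom.ker (partialToricHom k w S)).IsPrime := RingHom.ker_isPrime _
    have h2 : (RingHom.ker (partialToricHom k w (insert i S))).IsPrime := RingHom.ker_isPrime _
    have := Ideal.height_add_one_le_of_lt_of_isPrime hlt
    exact add_le_add_left (ih.trans this) 1

theorem height_toricIdeal [Fintype ι] [Nonempty ι] {w : ι → ℕ} (hw : ∀ i, 0 < w i) :
    (toricIdeal k w).height + 1 = Fintype.card ι := by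
  classical
  refine le_antisymm ?_ ?_
  · have hlt : toricIdeal k w < irrelevant k ι :=
      lt_of_le_of_ne (toricIdeal_le_irrelevant hw) fun h =>
        X_notMem_toricIdeal w (Classical.arbitrary ι) (h ▸ X_mem_irrelevant _)
    have h1 := Ideal.height_add_one_le_of_lt_of_isPrime hlt
    have h2 := Ideal.height_le_ringKrullDim_of_ne_top
      (Ideal.IsPrime.ne_top (I := irrelevant k ι) inferInstance)
    rw [MvPolynomial.ringKrullDim_of_isNoetherianRing, ringKrullDim_eq_zero_of_field,
      zero_add] at h2
    refine h1.trans ?_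
    have h3 : ((irrelevant k ι).height : WithBot ℕ∞) ≤ ((Fintype.card ι : ℕ∞) : WithBot ℕ∞) := by
      simpa using h2
    exact WithBot.coe_le_coe.1 h3
  · refine (card_le_height_ker_partialToricHom (k := k) w hw Finset.univ).trans ?_
    gcongr
    let θ : MvPolynomial (Option ι) k →ₐ[k] Polynomial k := aeval fun _ => Polynomial.X
    have hθ : θ.comp (partialToricHom k w Finset.univ) =
        aeval (fun i => (Polynomial.X : Polynomial k) ^ w i) := by
      ext1 l
      simp [θ, partialToricHom]
    intro f hf
    rw [mem_toricIdeal, ← hθ, AlgHom.comp_apply, RingHom.mem_ker.1 hf, map_zero]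

end Height

/-! ### Binomial generators, the lattice of relations and gluing a variable. -/

section Generators

variable {k : Type*} [Field k] {ι : Type*}

/-- This is the form in which the exchange principle yields every contradiction below. -/
theorem X_notMem_of_toricIdeal_le_span_sup_mul [Finite ι] {w : ι → ℕ}
    {G : Finset (MvPolynomial ι k)} (hcard : (G.card : ℕ∞) ≤ (toricIdeal k w).height)
    (hG : ∀ g ∈ G, g ∈ irrelevant k ι)
    (hI : toricIdeal k w ≤ Ideal.span G ⊔ irrelevant k ι * toricIdeal k w) (i : ι) :
    X i ∉ G := fun h =>
  X_notMem_toricIdeal w i (subset_of_le_span_sup_mul hcard hG hI h)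

theorem binomial_mem_irrelevant {w : ι → ℕ} (hw : ∀ i, 0 < w i) {u v : ι →₀ ℕ}
    (h : Finsupp.weight w u = Finsupp.weight w v) : binomial k u v ∈ irrelevant k ι :=
  toricIdeal_le_irrelevant hw (binomial_mem_toricIdeal h)

/-- A set of generators, modulo `m I`, of a toric ideal `I` can be chosen among the binomials
`x ^ u - x ^ v` without common variables and so that it contains a given set of such binomials,
which are separated by monomials of degree two. -/
theorem exists_binomial_extension [Finite ι] {w : ι → ℕ} (hw : ∀ i, 0 < w i)
    (hmin : ∀ i, ∀ u : ι →₀ ℕ, Finsupp.weight w u = w i → u = Finsupp.single i 1)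
    {Q : Set (MvPolynomial ι k)}
    (hQT : ∀ q ∈ Q, ∃ u v : ι →₀ ℕ, Finsupp.weight w u = Finsupp.weight w v ∧ u ≠ v ∧
      (∀ i, u i = 0 ∨ v i = 0) ∧ q = binomial k u v)
    (hQ : ∀ q ∈ Q, ∃ u : ι →₀ ℕ, u.degree = 2 ∧ coeff u q ≠ 0 ∧
      ∀ q' ∈ Q, q' ≠ q → coeff u q' = 0) :
    ∃ B : Finset (MvPolynomial ι k), Q ⊆ B ∧ B.card ≤ (toricIdeal k w).spanFinrank ∧
      (∀ q ∈ B, ∃ u v : ι →₀ ℕ, Finsupp.weight w u = Finsupp.weight w v ∧ u ≠ v ∧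
        (∀ i, u i = 0 ∨ v i = 0) ∧ q = binomial k u v) ∧
      toricIdeal k w ≤ Ideal.span B ⊔ irrelevant k ι * toricIdeal k w := by
  classical
  obtain ⟨F, hFcard, hF⟩ := Submodule.FG.exists_span_finset_card_eq_spanFinrank
    (IsNoetherian.noetherian (toricIdeal k w))
  let T : Set (MvPolynomial ι k) := {q | ∃ u v : ι →₀ ℕ,
    Finsupp.weight w u = Finsupp.weight w v ∧ u ≠ v ∧ (∀ i, u i = 0 ∨ v i = 0) ∧ q = binomial k u v}
  have hTI : T ⊆ toricIdeal k w := by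
    rintro _ ⟨u, v, huv, -, -, rfl⟩
    exact binomial_mem_toricIdeal huv
  have hIT : ∀ x ∈ toricIdeal k w, x ∈ Submodule.span k T ⊔
      (irrelevant k ι * toricIdeal k w).restrictScalars k := by
    intro x hx
    refine (Submodule.span_le.2 ?_) (toricIdeal_le_span_binomial w hx)
    rintro _ ⟨u, v, huv, rfl⟩
    by_cases h0 : u ⊓ v = 0
    · by_cases hne : u = v
      · simp [binomial, hne]
      · refine Submodule.mem_sup_left (Submodule.subset_span ⟨u, v, huv, hne, fun i => ?_, rfl⟩)
        have := DFunLike.congr_fun h0 i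
        simp only [Finsupp.inf_apply, Finsupp.coe_zero, Pi.zero_apply] at this
        omega
    -- A common factor of the two monomials lies in m, and the quotient binomial is still in the
    -- toric ideal.
    · refine Submodule.mem_sup_right ?_
      have hu : u ⊓ v + (u - u ⊓ v) = u := add_tsub_cancel_of_le inf_le_left
      have hv : u ⊓ v + (v - u ⊓ v) = v := add_tsub_cancel_of_le inf_le_right
      have h1 : Finsupp.weight w (u - u ⊓ v) = Finsupp.weight w (v - u ⊓ v) := by
        rw [← hu, ← hv, map_add, map_add] at huv
        simpa [hu, hv] using huv
      have h2 : binomial k u v = monomial (u ⊓ v) 1 * binomial k (u - u ⊓ v) (v - u ⊓ v) := by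
        rw [← binomial_add, hu, hv]
      rw [h2]
      exact Ideal.mul_mem_mul (monomial_mem_irrelevant h0 1) (binomial_mem_toricIdeal h1)
  have hQφ : ∀ q ∈ Q, ∃ φ : MvPolynomial ι k →ₗ[k] k,
      (∀ x ∈ irrelevant k ι * toricIdeal k w, φ x = 0) ∧ φ q ≠ 0 ∧
        ∀ q' ∈ Q, q' ≠ q → φ q' = 0 := by
    intro q hq
    obtain ⟨u, hu, hqu, hq'⟩ := hQ q hq
    exact ⟨lcoeff k u, fun x hx => coeff_eq_zero_of_mem_irrelevant_mul hw hmin hx hu, hqu, hq'⟩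
  obtain ⟨B, hQB, hBT, hcard, hB⟩ := exists_extension_le_span_sup_mul (k := k)
    exists_sub_algebraMap_mem_irrelevant F hF hQT hTI hIT hQφ
  exact ⟨B, hQB, hFcard ▸ hcard, hBT, hB⟩

/-- The binomials generating a toric ideal modulo `m I` span the lattice of relations. -/
theorem map_eq_of_toricIdeal_le_span_sup_mul {w : ι → ℕ} (hw : ∀ i, 0 < w i) {Q : Type*}
    [AddCommMonoid Q] (cls : (ι →₀ ℕ) →+ Q) {B : Set (MvPolynomial ι k)}
    (hB : ∀ f ∈ B, ∃ u v : ι →₀ ℕ, Finsupp.weight w u = Finsupp.weight w v ∧ cls u = cls v ∧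
      f = binomial k u v)
    (hI : toricIdeal k w ≤ Ideal.span B ⊔ irrelevant k ι * toricIdeal k w) {u v : ι →₀ ℕ}
    (huv : Finsupp.weight w u = Finsupp.weight w v) : cls u = cls v := by
  classical
  induction hb : Finsupp.weight w u using Nat.strong_induction_on generalizing u v with
  | _ b ih =>
  subst hb
  by_contra hne
  let P : (ι →₀ ℕ) → Prop := fun y => cls y = cls u ∧ Finsupp.weight w y = Finsupp.weight w u
  -- This functional sums the coefficients over the monomials with the degree and class of u. It
  -- kills the span of B because B preserves both, and kills m I by induction on the degree, yet
  -- takes the value 1 on the given binomial.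
  let ℓ : MvPolynomial ι k →ₗ[k] k :=
    (basisMonomials ι k).constr k fun y => if P y then 1 else 0
  have hℓ : ∀ y, ℓ (monomial y 1) = if P y then 1 else 0 := fun y => by
    have : (monomial y 1 : MvPolynomial ι k) = basisMonomials ι k y := by simp
    rw [this, Module.Basis.constr_basis]
  have hmul : ∀ (a : MvPolynomial ι k) (u' v' : ι →₀ ℕ),
      (∀ p ∈ a.support, P (p + u') ↔ P (p + v')) → ℓ (a * binomial k u' v') = 0 := by
    intro a u' v' h
    rw [a.as_sum, Finset.sum_mul, map_sum]
    refine Finset.sum_eq_zero fun p hp => ?_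
    have h1 : (monomial p (coeff p a) : MvPolynomial ι k) = coeff p a • monomial p 1 := by
      simp [smul_monomial]
    rw [h1, smul_mul_assoc, map_smul, ← binomial_add, binomial, map_sub, hℓ, hℓ,
      if_congr (h p hp) rfl rfl, sub_self, smul_zero]
  have hspan : ∀ f ∈ Ideal.span B, ℓ f = 0 := by
    intro f hf
    have : ∀ a : MvPolynomial ι k, ℓ (a * f) = 0 := by
      refine Submodule.span_induction (p := fun f _ => ∀ a : MvPolynomial ι k, ℓ (a * f) = 0)
        ?_ ?_ ?_ ?_ hf
      · rintro g hg a
        obtain ⟨u', v', hw', hc, rfl⟩ := hB g hg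
        refine hmul a u' v' fun p _ => ?_
        simp only [P, map_add, hw', hc]
      · simp
      · intro x y _ _ hx hy a
        rw [mul_add, map_add, hx, hy, add_zero]
      · intro b x _ hx a
        rw [smul_eq_mul, ← mul_assoc, hx]
    simpa using this 1
  have hirr : ∀ f ∈ irrelevant k ι * toricIdeal k w, ℓ f = 0 := by
    intro f hf
    refine Submodule.mul_induction_on hf (fun a ha g hg => ?_) fun x y hx hy => by
      rw [map_add, hx, hy, add_zero]
    refine Submodule.span_induction (p := fun g _ => ℓ (a * g) = 0) ?_ ?_ ?_ ?_
      (toricIdeal_le_span_binomial w hg)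
    · rintro _ ⟨u', v', hw', rfl⟩
      refine hmul a u' v' fun p hp => ?_
      have hp0 : p ≠ 0 := by
        rintro rfl
        exact (mem_support_iff.1 hp) (by rw [← constantCoeff_eq]; exact mem_irrelevant.1 ha)
      have hpw : Finsupp.weight w p ≠ 0 := fun h => hp0 (weight_eq_zero hw h)
      have hcls : Finsupp.weight w (p + u') = Finsupp.weight w u → cls u' = cls v' := by
        intro h
        rw [map_add] at h
        exact ih _ (by omega) hw' rfl
      constructor
      · rintro ⟨h1, h2⟩
        refine ⟨?_, by rw [map_add, ← hw', ← map_add, h2]⟩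
        rw [map_add, ← hcls h2, ← map_add, h1]
      · rintro ⟨h1, h2⟩
        have h3 : Finsupp.weight w (p + u') = Finsupp.weight w u := by
          rw [map_add, hw', ← map_add, h2]
        refine ⟨?_, h3⟩
        rw [map_add, hcls h3, ← map_add, h1]
    · simp
    · intro x y _ _ hx hy
      rw [mul_add, map_add, hx, hy, add_zero]
    · intro c x _ hx
      rw [mul_smul_comm, map_smul, hx, smul_zero]
  obtain ⟨s, hs, z, hz, hsz⟩ := Submodule.mem_sup.1 (hI (binomial_mem_toricIdeal huv))
  have h1 : ℓ (binomial k u v) = 0 := by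
    rw [← hsz, map_add, hspan s hs, hirr z hz, add_zero]
  rw [binomial, map_sub, hℓ, hℓ, if_pos ⟨rfl, rfl⟩, if_neg fun h => hne h.1.symm, sub_zero] at h1
  exact one_ne_zero h1

/-- The ideal `J` identifies any two monomials of the same degree in the variables of `S`. -/
def ConnectsFibers (J : Ideal (MvPolynomial ι k)) (w : ι → ℕ) (S : Set ι) : Prop :=
  ∀ u v : ι →₀ ℕ, (∀ i ∉ S, u i = 0) → (∀ i ∉ S, v i = 0) →
    Finsupp.weight w u = Finsupp.weight w v → binomial k u v ∈ J

theorem toricIdeal_le_of_connectsFibers {J : Ideal (MvPolynomial ι k)} {w : ι → ℕ}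
    (h : ConnectsFibers J w Set.univ) : toricIdeal k w ≤ J :=
  toricIdeal_le_of_binomial_mem fun u v huv => h u v (by simp) (by simp) huv

/-- Modulo J, powers x_i^c can be rewritten as x^p, so exponents of x_i may be taken below c. For
monomials of equal degree these remainders differ by a multiple of c, hence agree, and the case of S
applies. -/
theorem ConnectsFibers.insert {J : Ideal (MvPolynomial ι k)} {w : ι → ℕ} {S : Set ι}
    (hS : ConnectsFibers J w S) {i : ι} (hi : i ∉ S) {c : ℕ} (hc : 0 < c) {p : ι →₀ ℕ}
    (hp : ∀ j ∉ S, p j = 0) (hpw : c * w i = Finsupp.weight w p)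
    (hJ : binomial k (Finsupp.single i c) p ∈ J)
    (hdvd : ∀ (a : ℕ) (u v : ι →₀ ℕ), (∀ j ∉ S, u j = 0) → (∀ j ∉ S, v j = 0) →
      a * w i + Finsupp.weight w u = Finsupp.weight w v → c ∣ a) :
    ConnectsFibers J w (insert i S) := by
  classical
  have hbin : ∀ u v : ι →₀ ℕ, binomial k u v ∈ J ↔
      Ideal.Quotient.mk J (monomial u 1) = Ideal.Quotient.mk J (monomial v 1) :=
    fun u v => Ideal.Quotient.eq.symm
  have hadd : ∀ u v : ι →₀ ℕ, Ideal.Quotient.mk J (monomial (u + v) 1) =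
      Ideal.Quotient.mk J (monomial u 1) * Ideal.Quotient.mk J (monomial v 1) := fun u v => by
    rw [← map_mul, monomial_mul, one_mul]
  have hpow : ∀ (n : ℕ) (u : ι →₀ ℕ), Ideal.Quotient.mk J (monomial (n • u) 1) =
      Ideal.Quotient.mk J (monomial u 1) ^ n := fun n u => by
    rw [← map_pow, monomial_pow, one_pow]
  have hred : ∀ u : ι →₀ ℕ, (∀ j ∉ Insert.insert i S, u j = 0) → ∃ (r : ℕ) (u₀ : ι →₀ ℕ), r < c ∧
      (∀ j ∉ S, u₀ j = 0) ∧ Finsupp.weight w u = r * w i + Finsupp.weight w u₀ ∧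
      Ideal.Quotient.mk J (monomial u 1) =
        Ideal.Quotient.mk J (monomial (Finsupp.single i r + u₀) 1) := by
    intro u hu
    have hdec : u = c • 0 + ((u i / c) • Finsupp.single i c +
        (Finsupp.single i (u i % c) + u.erase i)) := by
      rw [smul_zero, zero_add, ← add_assoc, Finsupp.smul_single, ← Finsupp.single_add, smul_eq_mul,
        mul_comm, Nat.div_add_mod, Finsupp.single_add_erase]
    refine ⟨u i % c, (u i / c) • p + u.erase i, Nat.mod_lt _ hc, fun j hj => ?_, ?_, ?_⟩
    · by_cases hji : j = i
      · subst hji; simp [hp j hj]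
      · simp [hp j hj, hji, hu j (by simp [hji, hj])]
    · conv_lhs => rw [hdec]
      simp only [map_add, map_nsmul, Finsupp.weight_single, ← hpw, smul_eq_mul]
      simp
      ring
    · conv_lhs => rw [hdec]
      rw [smul_zero, zero_add]
      rw [hadd, hpow, (hbin _ _).1 hJ, hadd, hadd, hadd, hpow]
      ring
  intro u v hu hv huv
  obtain ⟨r, u₀, hr, hu₀, huw, hum⟩ := hred u hu
  obtain ⟨s, v₀, hs, hv₀, hvw, hvm⟩ := hred v hv
  rw [hbin, hum, hvm]
  have hrs : r = s := by
    rcases le_total s r with h | h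
    · have h1 : (r - s) * w i + Finsupp.weight w u₀ = Finsupp.weight w v₀ := by
        zify [h]
        have : (r * w i + Finsupp.weight w u₀ : ℤ) = s * w i + Finsupp.weight w v₀ := by
          exact_mod_cast (huw.symm.trans huv).trans hvw
        linarith
      have := Nat.eq_zero_of_dvd_of_lt (hdvd _ _ _ hu₀ hv₀ h1) (by omega)
      omega
    · have h1 : (s - r) * w i + Finsupp.weight w v₀ = Finsupp.weight w u₀ := by
        zify [h]
        have : (r * w i + Finsupp.weight w u₀ : ℤ) = s * w i + Finsupp.weight w v₀ := by
          exact_mod_cast (huw.symm.trans huv).trans hvw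
        linarith
      have := Nat.eq_zero_of_dvd_of_lt (hdvd _ _ _ hv₀ hu₀ h1) (by omega)
      omega
  subst hrs
  rw [hadd, hadd, (hbin u₀ v₀).1 (hS u₀ v₀ hu₀ hv₀ (by omega))]

end Generators

/-! ### Reductions of finite sets to the empty set. -/

section Reduction

theorem reflTransGen_redStep_erase {B : Finset ℕ} {b c : ℕ} (hb : b ∈ B)
    (hc : IsLeast {c : ℕ | 0 < c ∧ ((c * b : ℕ) : ℤ) ∈
        AddSubgroup.closure ((fun a : ℕ => (a : ℤ)) '' (B.erase b : Finset ℕ))} c)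
    (h : c * b ∈ AddSubmonoid.closure ((B.erase b : Finset ℕ) : Set ℕ)) :
    Relation.ReflTransGen RedStep B (B.erase b) := by
  have h1 := RedStep.scale B b hb c hc
  by_cases hmem : c * b ∈ B.erase b
  · rw [Finset.insert_eq_self.2 hmem] at h1
    exact Relation.ReflTransGen.single h1
  · have h2 := RedStep.removeNat (insert (c * b) (B.erase b)) (c * b)
      (Finset.mem_insert_self _ _) (by rwa [Finset.erase_insert hmem])
    rw [Finset.erase_insert hmem] at h2
    exact (Relation.ReflTransGen.single h1).tail h2

theorem reflTransGen_redStep_singleton {r : ℕ} (hr : 0 < r) :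
    Relation.ReflTransGen RedStep {r} ∅ := by
  have := RedStep.removeRat {r} r (by simp) (by simp [hr.ne'])
  simpa using Relation.ReflTransGen.single this

theorem intCast_mem_closure_pair_iff {q r : ℕ} {z : ℤ} :
    z ∈ AddSubgroup.closure ((fun a : ℕ => (a : ℤ)) '' ({q, r} : Set ℕ)) ↔
      ∃ x y : ℤ, z = x * q + y * r := by
  rw [Set.image_pair, AddSubgroup.mem_closure_pair]
  simp [eq_comm]

theorem mem_closure_pair_iff {q r n : ℕ} :
    n ∈ AddSubmonoid.closure ({q, r} : Set ℕ) ↔ ∃ x y : ℕ, n = x * q + y * r := by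
  rw [AddSubmonoid.mem_closure_pair]
  simp [eq_comm]

/-- The multipliers of p that land in ℤq + ℤr form an ideal of ℤ, and its least positive element
generates it. -/
theorem isLeast_iff_forall_dvd {p q r c : ℕ} :
    IsLeast {c : ℕ | 0 < c ∧ ((c * p : ℕ) : ℤ) ∈
        AddSubgroup.closure ((fun a : ℕ => (a : ℤ)) '' ({q, r} : Set ℕ))} c ↔
      0 < c ∧ (∃ x y : ℤ, (c * p : ℤ) = x * q + y * r) ∧
        ∀ m x y : ℤ, m * p = x * q + y * r → (c : ℤ) ∣ m := by
  simp only [intCast_mem_closure_pair_iff, Nat.cast_mul]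
  constructor
  · rintro ⟨⟨hc, x₀, y₀, h₀⟩, hlb⟩
    refine ⟨hc, ⟨x₀, y₀, h₀⟩, fun m x y h => ?_⟩
    by_contra hdvd
    have hc' : (0 : ℤ) < c := by exact_mod_cast hc
    have hpos : 0 < m % c := lt_of_le_of_ne (Int.emod_nonneg _ hc'.ne')
      fun h0 => hdvd (Int.dvd_of_emod_eq_zero h0.symm)
    have hlt := Int.emod_lt_of_pos m hc'
    have hm : m % c = m - c * (m / c) := by rw [Int.emod_def]
    have h1 := hlb (a := (m % c).toNat)
      ⟨by omega, x - (m / c) * x₀, y - (m / c) * y₀, by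
        rw [Int.toNat_of_nonneg hpos.le, hm]; linear_combination h - (m / c) * h₀⟩
    omega
  · rintro ⟨hc, h₀, hdvd⟩
    refine ⟨⟨hc, h₀⟩, ?_⟩
    rintro m ⟨hm, x, y, h⟩
    exact Nat.le_of_dvd hm (by exact_mod_cast hdvd m x y h)

theorem isReduction_pair {q r : ℕ} (hq : 0 < q) (hr : 0 < r) (hqr : q ≠ r) :
    Relation.ReflTransGen RedStep {q, r} ∅ := by
  have he : ({q, r} : Finset ℕ).erase q = {r} := by
    ext x; simp; omega
  -- The singleton is written as a degenerate pair so that the criteria for pairs apply.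
  have hset : ((({q, r} : Finset ℕ).erase q : Finset ℕ) : Set ℕ) = {r, r} := by
    rw [he]; simp
  have h1 : Relation.ReflTransGen RedStep {q, r} (({q, r} : Finset ℕ).erase q) := by
    have hg : 0 < Nat.gcd q r := Nat.gcd_pos_of_pos_left _ hq
    obtain ⟨q', hq'⟩ := Nat.gcd_dvd_left q r
    obtain ⟨r', hr'⟩ := Nat.gcd_dvd_right q r
    have hcop : Nat.Coprime q' r' := by
      have := Nat.coprime_div_gcd_div_gcd hg
      rwa [Nat.div_eq_of_eq_mul_right hg hq', Nat.div_eq_of_eq_mul_right hg hr'] at this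
    have hmul : r' * q = q' * r := by
      generalize Nat.gcd q r = g at *
      subst hq' hr'; ring
    refine reflTransGen_redStep_erase (c := r') (by simp) ?_ ?_
    · rw [hset, isLeast_iff_forall_dvd]
      refine ⟨Nat.pos_of_ne_zero fun h => by simp [h] at hr'; omega,
        ⟨q', 0, by rw [zero_mul, add_zero]; exact_mod_cast hmul⟩, fun m x y h => ?_⟩
      have h2 : (r' : ℤ) ∣ m * q' := by
        have hgz : ((Nat.gcd q r : ℕ) : ℤ) ≠ 0 := by exact_mod_cast hg.ne'
        refine ⟨x + y, mul_left_cancel₀ hgz ?_⟩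
        have e1 : (q : ℤ) = (Nat.gcd q r : ℕ) * q' := by exact_mod_cast hq'
        have e2 : (r : ℤ) = (Nat.gcd q r : ℕ) * r' := by exact_mod_cast hr'
        linear_combination h - m * e1 + (x + y) * e2
      exact IsCoprime.dvd_of_dvd_mul_right (Nat.isCoprime_iff_coprime.2 hcop.symm) h2
    · rw [hset, mem_closure_pair_iff]
      exact ⟨q', 0, by rw [hmul]; ring⟩
  rw [he] at h1
  exact h1.trans (reflTransGen_redStep_singleton hr)

theorem isReduction_triple {p q r c x y : ℕ} (hq : 0 < q) (hr : 0 < r)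
    (hpq : p ≠ q) (hpr : p ≠ r) (hqr : q ≠ r) (hc : 0 < c) (h : c * p = x * q + y * r)
    (hdvd : ∀ m x y : ℤ, m * p = x * q + y * r → (c : ℤ) ∣ m) :
    IsReduction {p, q, r} ∅ := by
  refine ⟨?_, by simp⟩
  have he : ({p, q, r} : Finset ℕ).erase p = {q, r} := by
    rw [Finset.erase_insert]; simp [hpq, hpr]
  have h1 : Relation.ReflTransGen RedStep {p, q, r} (({p, q, r} : Finset ℕ).erase p) := by
    refine reflTransGen_redStep_erase (c := c) (by simp) ?_ ?_
    · rw [he, Finset.coe_pair, isLeast_iff_forall_dvd]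
      exact ⟨hc, ⟨x, y, by exact_mod_cast h⟩, hdvd⟩
    · rw [he, Finset.coe_pair, mem_closure_pair_iff]
      exact ⟨x, y, h⟩
  rw [he] at h1
  exact h1.trans (isReduction_pair hq hr hqr)

/-- A set of three positive integers which reduces to the empty set is obtained by gluing one of
its elements to the other two. -/
theorem exists_of_reflTransGen_redStep_empty {B : Finset ℕ}
    (hB : Relation.ReflTransGen RedStep B ∅) (hpos : ∀ b ∈ B, 0 < b) {p q r : ℕ}
    (hpq : p ≠ q) (hpr : p ≠ r) (hqr : q ≠ r) (hpqr : B = {p, q, r}) :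
    ∃ p' q' r' c x y : ℕ, ({p', q', r'} : Finset ℕ) = B ∧ p' ≠ q' ∧ p' ≠ r' ∧ q' ≠ r' ∧
      0 < c ∧ c * p' = x * q' + y * r' ∧
      ∀ m x y : ℤ, m * p' = x * q' + y * r' → (c : ℤ) ∣ m := by
  induction hB using Relation.ReflTransGen.head_induction_on generalizing p q r with
  | refl => exact absurd hpqr.symm (Finset.insert_ne_empty _ _)
  | @head B B₁ hstep _ ih =>
    have herase : ∀ b ∈ B, ∃ s t, b ≠ s ∧ b ≠ t ∧ s ≠ t ∧ B.erase b = {s, t} ∧ B = {b, s, t} := by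
      intro b hb
      subst hpqr
      simp only [Finset.mem_insert, Finset.mem_singleton] at hb
      rcases hb with rfl | rfl | rfl
      · exact ⟨q, r, hpq, hpr, hqr, by ext x; simp; omega, rfl⟩
      · exact ⟨p, r, hpq.symm, hqr, hpr, by ext x; simp; omega, by ext x; simp; omega⟩
      · exact ⟨p, q, hpr.symm, hqr.symm, hpq, by ext x; simp; omega, by ext x; simp; omega⟩
    cases hstep with
    | removeRat b hb h =>
      exfalso
      obtain ⟨s, t, -, -, -, he, hBe⟩ := herase b hb
      have hs : 0 < s := hpos s (by rw [hBe]; simp)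
      apply h
      rw [he]
      have h1 : (s : ℚ) ∈ Submodule.span ℚ ((fun a : ℕ => (a : ℚ)) '' (({s, t} : Finset ℕ) : Set ℕ)) :=
        Submodule.subset_span ⟨s, by simp, rfl⟩
      have h2 := Submodule.smul_mem _ ((b : ℚ) / s) h1
      rwa [smul_eq_mul, div_mul_cancel₀ _ (by exact_mod_cast hs.ne')] at h2
    | removeNat b hb h =>
      obtain ⟨s, t, hbs, hbt, hst, he, hBe⟩ := herase b hb
      rw [he, Finset.coe_pair, mem_closure_pair_iff] at h
      obtain ⟨x, y, hxy⟩ := h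
      exact ⟨b, s, t, 1, x, y, hBe.symm, hbs, hbt, hst, one_pos, by rw [one_mul, hxy], by simp⟩
    | scale b hb c h =>
      obtain ⟨s, t, hbs, hbt, hst, he, hBe⟩ := herase b hb
      rw [he] at ih
      rw [he, Finset.coe_pair, isLeast_iff_forall_dvd] at h
      obtain ⟨hc, ⟨x₀, y₀, h₀⟩, hdvd⟩ := h
      -- If scaling makes two elements coincide, the set drops to two elements and induction does
      -- not apply, but the coincidence is itself the gluing.
      by_cases hcs : c * b = s
      · exact ⟨b, s, t, c, 1, 0, hBe.symm, hbs, hbt, hst, hc, by rw [hcs]; ring, hdvd⟩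
      by_cases hct : c * b = t
      · exact ⟨b, s, t, c, 0, 1, hBe.symm, hbs, hbt, hst, hc, by rw [hct]; ring, hdvd⟩
      have hbpos := hpos b hb
      have hpos' : ∀ b' ∈ ({c * b, s, t} : Finset ℕ), 0 < b' := by
        intro b' hb'
        simp only [Finset.mem_insert, Finset.mem_singleton] at hb'
        rcases hb' with rfl | rfl | rfl
        · positivity
        · exact hpos _ (by rw [hBe]; simp)
        · exact hpos _ (by rw [hBe]; simp)
      obtain ⟨p', q', r', c', x, y, hset, hpq', hpr', hqr', hc', hcomb, hdvd'⟩ :=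
        ih hpos' hcs hct hst rfl
      -- the set of multipliers of `s` is not changed by the scaling of `b`
      have hs : ∀ s t, b ≠ s → b ≠ t → s ≠ t → B = {b, s, t} →
          (∀ m x y : ℤ, m * b = x * s + y * t → (c : ℤ) ∣ m) →
          ∀ x y : ℕ, c' * s = x * (c * b) + y * t →
          (∀ m x y : ℤ, m * s = x * (c * b) + y * t → (c' : ℤ) ∣ m) →
          ∃ p' q' r' c x y : ℕ, ({p', q', r'} : Finset ℕ) = B ∧ p' ≠ q' ∧ p' ≠ r' ∧ q' ≠ r' ∧
            0 < c ∧ c * p' = x * q' + y * r' ∧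
            ∀ m x y : ℤ, m * p' = x * q' + y * r' → (c : ℤ) ∣ m := by
        intro s t hbs hbt hst hBe hd x y hx hd'
        refine ⟨s, b, t, c', x * c, y, by rw [hBe, Finset.insert_comm], hbs.symm, hst, hbt, hc',
          by rw [hx]; ring, fun m x y hm => ?_⟩
        -- In any relation of s with b and t the coefficient of b is divisible by c, so it is also a
        -- relation with c * b and t.
        obtain ⟨z, rfl⟩ := hd x m (-y) (by linear_combination -hm)
        exact hd' m z y (by linear_combination hm)
      have hmem : p' ∈ ({c * b, s, t} : Finset ℕ) := by rw [← hset]; simp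
      have hperm : ∀ {u v : ℕ}, u ≠ v → u ≠ p' → v ≠ p' →
          u ∈ ({p', q', r'} : Finset ℕ) → v ∈ ({p', q', r'} : Finset ℕ) →
          (u = q' ∧ v = r') ∨ (u = r' ∧ v = q') := by
        intro u v h1 h2 h3 h4 h5
        simp only [Finset.mem_insert, Finset.mem_singleton] at h4 h5
        omega
      have hswap : ∀ {u v : ℕ}, (u = q' ∧ v = r') ∨ (u = r' ∧ v = q') →
          (∃ x y : ℕ, c' * p' = x * u + y * v) ∧
            ∀ m x y : ℤ, m * p' = x * u + y * v → (c' : ℤ) ∣ m := by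
        rintro u v (⟨rfl, rfl⟩ | ⟨rfl, rfl⟩)
        · exact ⟨⟨x, y, hcomb⟩, hdvd'⟩
        · exact ⟨⟨y, x, by rw [hcomb]; ring⟩,
            fun m x y h => hdvd' m y x (by linear_combination h)⟩
      simp only [Finset.mem_insert, Finset.mem_singleton] at hmem
      rcases hmem with h | h | h
      · obtain ⟨⟨x, y, h1⟩, h2⟩ := hswap (hperm hst (by omega) (by omega)
          (by rw [hset]; simp) (by rw [hset]; simp))
        -- The scaled element already lies in the group spanned by s and t, so its own least
        -- multiplier is trivial.
        have h3 : c' = 1 := by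
          have := h2 1 x₀ y₀ (by rw [h]; push_cast; linear_combination h₀)
          have := Int.natCast_dvd_natCast.1 (by exact_mod_cast this : (c' : ℤ) ∣ ((1 : ℕ) : ℤ))
          exact Nat.dvd_one.1 this
        exact ⟨b, s, t, c, x, y, hBe.symm, hbs, hbt, hst, hc, by rw [← h1, h3, h]; ring, hdvd⟩
      · obtain ⟨⟨x, y, h1⟩, h2⟩ := hswap (hperm (u := c * b) (v := t) (by omega) (by omega)
          (by omega) (by rw [hset]; simp) (by rw [hset]; simp))
        rw [h] at h1 h2
        exact hs s t hbs hbt hst hBe hdvd x y h1 (by exact_mod_cast h2)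
      · obtain ⟨⟨x, y, h1⟩, h2⟩ := hswap (hperm (u := c * b) (v := s) (by omega) (by omega)
          (by omega) (by rw [hset]; simp) (by rw [hset]; simp))
        rw [h] at h1 h2
        refine hs t s hbt hbs hst.symm (by rw [hBe, Finset.pair_comm]) (fun m x y hm =>
          hdvd m y x (by linear_combination hm)) x y h1 (by exact_mod_cast h2)

end Reduction

/-! ### Four variables: exponents, and gluing implies complete intersection. -/

section FourGenerators

variable {k : Type*} [Field k] {ι : Type*}

theorem weight_eq_sum_fin_four [Fintype ι] (w : ι → ℕ) (e : Fin 4 ≃ ι) (u : ι →₀ ℕ) :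
    Finsupp.weight w u =
      u (e 0) * w (e 0) + u (e 1) * w (e 1) + u (e 2) * w (e 2) + u (e 3) * w (e 3) := by
  rw [Finsupp.weight_apply, Finsupp.sum_fintype _ _ (by simp),
    ← e.sum_comp, Fin.sum_univ_four]
  simp only [smul_eq_mul]

/-- The exponent with given values on the image of `e`, which vanishes elsewhere. -/
noncomputable def exponent (e : Fin 4 ↪ ι) (f : Fin 4 → ℕ) : ι →₀ ℕ :=
  Finsupp.embDomain e (Finsupp.equivFunOnFinite.symm f)

@[simp]
theorem exponent_apply (e : Fin 4 ↪ ι) (f : Fin 4 → ℕ) (j : Fin 4) : exponent e f (e j) = f j := by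
  simp [exponent]

@[simp]
theorem exponent_toEmbedding_apply (e : Fin 4 ≃ ι) (f : Fin 4 → ℕ) (j : Fin 4) :
    exponent e.toEmbedding f (e j) = f j :=
  exponent_apply e.toEmbedding f j

theorem exponent_injective (e : Fin 4 ↪ ι) : Function.Injective (exponent e) := fun f g h => by
  ext j
  rw [← exponent_apply e f, h, exponent_apply]

theorem exponent_eq_zero_or {e : Fin 4 ↪ ι} {f g : Fin 4 → ℕ} (h : ∀ j, f j = 0 ∨ g j = 0) (i : ι) :
    exponent e f i = 0 ∨ exponent e g i = 0 := by
  by_cases hi : i ∈ Set.range e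
  · obtain ⟨j, rfl⟩ := hi
    simpa using h j
  · left
    exact Finsupp.embDomain_of_notMem_range _ _ _ hi

theorem weight_exponent (w : ι → ℕ) (e : Fin 4 ↪ ι) (f : Fin 4 → ℕ) :
    Finsupp.weight w (exponent e f) =
      f 0 * w (e 0) + f 1 * w (e 1) + f 2 * w (e 2) + f 3 * w (e 3) := by
  rw [Finsupp.weight_apply, exponent, Finsupp.sum_embDomain, Finsupp.sum_fintype _ _ (by simp),
    Fin.sum_univ_four]
  simp

theorem degree_exponent (e : Fin 4 ↪ ι) (f : Fin 4 → ℕ) :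
    (exponent e f).degree = f 0 + f 1 + f 2 + f 3 := by
  have := weight_exponent (fun _ => 1) e f
  rw [Finsupp.degree_eq_weight_one]
  simpa using this

theorem coeff_exponent_binomial (e : Fin 4 ↪ ι) (f g g' : Fin 4 → ℕ) :
    coeff (exponent e f) (binomial k (exponent e g) (exponent e g')) =
      (if g = f then 1 else 0) - if g' = f then 1 else 0 := by
  classical
  rw [binomial, coeff_sub, coeff_monomial, coeff_monomial]
  simp only [(exponent_injective e).eq_iff]

theorem height_toricIdeal_eq_three [Fintype ι] {w : ι → ℕ} (hw : ∀ i, 0 < w i)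
    (hcard : Fintype.card ι = 4) : (toricIdeal k w).height = 3 := by
  have : Nonempty ι := Fintype.card_pos_iff.1 (by omega)
  have h1 := height_toricIdeal (k := k) hw
  rw [hcard] at h1
  have h2 : (toricIdeal k w).height + 1 = 3 + 1 := by rw [h1]; norm_num
  exact (ENat.add_left_injective_of_ne_top (by simp)) h2

theorem isCompleteIntersection_of_span [Fintype ι] {w : ι → ℕ} (hw : ∀ i, 0 < w i)
    (hcard : Fintype.card ι = 4) {f g h : MvPolynomial ι k}
    (hI : toricIdeal k w = Ideal.span {f, g, h}) : IsCompleteIntersection (toricIdeal k w) := by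
  classical
  have h2 := height_toricIdeal_eq_three (k := k) hw hcard
  have h3 := Ideal.height_le_spanFinrank (toricIdeal k w) (Ideal.IsPrime.ne_top inferInstance)
  have h4 : (toricIdeal k w).spanFinrank ≤ 3 := by
    rw [hI]
    have := Submodule.spanFinrank_span_le_ncard_of_finite (R := MvPolynomial ι k)
      (s := (({f, g, h} : Finset (MvPolynomial ι k)) : Set (MvPolynomial ι k)))
      (Finset.finite_toSet _)
    rw [Set.ncard_coe_finset] at this
    simpa using this.trans Finset.card_le_three
  refine le_antisymm ?_ h3
  rw [h2]
  exact_mod_cast h4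

/-- If the generators of a semigroup are glued one by one, the toric ideal is a complete
intersection. -/
theorem isCompleteIntersection_of_gluing [Fintype ι] {w : ι → ℕ} (hw : ∀ i, 0 < w i)
    (e : Fin 4 ≃ ι) {d : Fin 4 → ℕ} (hd : ∀ j, w (e j) = d j) {c₀ p₁ p₂ p₃ c₁ q₂ q₃ : ℕ}
    (hc₀ : 0 < c₀) (h₀ : c₀ * d 0 = p₁ * d 1 + p₂ * d 2 + p₃ * d 3)
    (hdvd₀ : ∀ a x y z : ℤ, a * d 0 = x * d 1 + y * d 2 + z * d 3 → (c₀ : ℤ) ∣ a)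
    (hc₁ : 0 < c₁) (h₁ : c₁ * d 1 = q₂ * d 2 + q₃ * d 3)
    (hdvd₁ : ∀ a x y : ℤ, a * d 1 = x * d 2 + y * d 3 → (c₁ : ℤ) ∣ a) :
    IsCompleteIntersection (toricIdeal k w) := by
  classical
  have hpos : ∀ j, 0 < d j := fun j => hd j ▸ hw (e j)
  have hwt := fun u => (weight_eq_sum_fin_four w e u).trans (by rw [hd, hd, hd, hd])
  have hsingle : ∀ j c l, (Finsupp.single (e j) c : ι →₀ ℕ) (e l) = if j = l then c else 0 := by
    intro j c l
    rw [Finsupp.single_apply]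
    exact if_congr e.injective.eq_iff rfl rfl
  -- Two positive integers are always glued, through their quotients by the gcd.
  obtain ⟨c₂, s, hc₂, h₂, hdvd₂⟩ : ∃ c₂ s : ℕ, 0 < c₂ ∧ c₂ * d 2 = s * d 3 ∧
      ∀ a x : ℤ, a * d 2 = x * d 3 → (c₂ : ℤ) ∣ a := by
    have hg : 0 < Nat.gcd (d 2) (d 3) := Nat.gcd_pos_of_pos_left _ (hpos 2)
    obtain ⟨s, t, hcop, hs, ht⟩ := Nat.exists_coprime (d 2) (d 3)
    generalize Nat.gcd (d 2) (d 3) = g at *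
    refine ⟨t, s, Nat.pos_of_ne_zero fun h => (hpos 3).ne' (by rw [ht, h, zero_mul]),
      by rw [hs, ht]; ring, fun a x h => ?_⟩
    have h2 : (t : ℤ) ∣ a * s := by
      have hgz : (g : ℤ) ≠ 0 := by exact_mod_cast hg.ne'
      refine ⟨x, mul_right_cancel₀ hgz ?_⟩
      rw [hs, ht] at h
      push_cast at h
      linear_combination h
    exact IsCoprime.dvd_of_dvd_mul_right (Nat.isCoprime_iff_coprime.2 hcop.symm) h2
  let P := exponent e.toEmbedding ![0, p₁, p₂, p₃]
  let Q := exponent e.toEmbedding ![0, 0, q₂, q₃]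
  let R := exponent e.toEmbedding ![0, 0, 0, s]
  let f := binomial k (Finsupp.single (e 0) c₀) P
  let g := binomial k (Finsupp.single (e 1) c₁) Q
  let h := binomial k (Finsupp.single (e 2) c₂) R
  have hmem : ∀ S : Set (Fin 4), ∀ u : ι →₀ ℕ, (∀ j ∉ e '' S, u j = 0) ↔ ∀ j ∉ S, u (e j) = 0 := by
    intro S u
    refine ⟨fun h j hj => h _ (by simpa using hj), fun h j hj => ?_⟩
    obtain ⟨l, rfl⟩ := e.surjective j
    exact h l fun hl => hj ⟨l, hl, rfl⟩
  set J : Ideal (MvPolynomial ι k) := Ideal.span {f, g, h} with hJ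
  have hfJ : f ∈ J := Ideal.subset_span (by simp)
  have hgJ : g ∈ J := Ideal.subset_span (by simp)
  have hhJ : h ∈ J := Ideal.subset_span (by simp)
  have s3 : ConnectsFibers J w (e '' {3}) := by
    intro u v hu hv huv
    rw [hmem] at hu hv
    have huv' : u = v := by
      ext i
      obtain ⟨j, rfl⟩ := e.surjective i
      rw [hwt, hwt] at huv
      have hu0 := hu 0 (by simp)
      have hu1 := hu 1 (by simp)
      have hu2 := hu 2 (by simp)
      have hv0 := hv 0 (by simp)
      have hv1 := hv 1 (by simp)
      have hv2 := hv 2 (by simp)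
      simp only [hu0, hu1, hu2, hv0, hv1, hv2, zero_mul, zero_add] at huv
      have := Nat.eq_of_mul_eq_mul_right (hpos 3) huv
      fin_cases j <;> simp_all
    simp [binomial, huv']
  have s2 : ConnectsFibers J w (e '' {2, 3}) := by
    rw [Set.image_insert_eq]
    refine s3.insert (by simp) hc₂ (p := R) ?_ ?_ hhJ ?_
    · rw [hmem]; intro j hj; fin_cases j <;> simp_all [R]
    · rw [hwt, hd]; simp [R, h₂]
    · intro a u v hu hv huv
      rw [hmem] at hu hv
      rw [hwt, hwt, hd, hu 0 (by simp), hu 1 (by simp), hu 2 (by simp),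
        hv 0 (by simp), hv 1 (by simp), hv 2 (by simp)] at huv
      zify at huv
      exact_mod_cast hdvd₂ a (v (e 3) - u (e 3)) (by linear_combination huv)
  have s1 : ConnectsFibers J w (e '' {1, 2, 3}) := by
    rw [Set.image_insert_eq]
    refine s2.insert (by simp) hc₁ (p := Q) ?_ ?_ hgJ ?_
    · rw [hmem]; intro j hj; fin_cases j <;> simp_all [Q]
    · rw [hwt, hd]; simp [Q, h₁]
    · intro a u v hu hv huv
      rw [hmem] at hu hv
      rw [hwt, hwt, hd, hu 0 (by simp), hu 1 (by simp), hv 0 (by simp), hv 1 (by simp)] at huv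
      zify at huv
      exact_mod_cast hdvd₁ a (v (e 2) - u (e 2)) (v (e 3) - u (e 3)) (by linear_combination huv)
  have s0 : ConnectsFibers J w (e '' {0, 1, 2, 3}) := by
    rw [Set.image_insert_eq]
    refine s1.insert (by simp) hc₀ (p := P) ?_ ?_ hfJ ?_
    · rw [hmem]; intro j hj; fin_cases j <;> simp_all [P]
    · rw [hwt, hd]; simp [P, h₀]
    · intro a u v hu hv huv
      rw [hmem] at hu hv
      rw [hwt, hwt, hd, hu 0 (by simp), hv 0 (by simp)] at huv
      zify at huv
      exact_mod_cast hdvd₀ a (v (e 1) - u (e 1)) (v (e 2) - u (e 2)) (v (e 3) - u (e 3))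
        (by linear_combination huv)
  have huniv : e '' {0, 1, 2, 3} = Set.univ := by
    have : ({0, 1, 2, 3} : Set (Fin 4)) = Set.univ := by
      ext j; fin_cases j <;> simp
    rw [this, Set.image_univ, e.range_eq_univ]
  rw [huniv] at s0
  refine isCompleteIntersection_of_span hw (by rw [← Fintype.card_congr e, Fintype.card_fin])
    (f := f) (g := g) (h := h) (le_antisymm (toricIdeal_le_of_connectsFibers s0) ?_)
  rw [Ideal.span_le]
  rintro _ (rfl | rfl | rfl)
  · refine binomial_mem_toricIdeal ?_
    rw [hwt, hwt]; simp [P, hsingle, h₀]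
  · refine binomial_mem_toricIdeal ?_
    rw [hwt, hwt]; simp [Q, hsingle, h₁]
  · refine binomial_mem_toricIdeal ?_
    rw [hwt, hwt]; simp [R, hsingle, h₂]

end FourGenerators

/-! ### Exchange obstructions in a complete intersection. -/

section Necessity

variable {k : Type*} [Field k] {ι : Type*}

theorem binomial_mem_span_of_X_mem {G : Set (MvPolynomial ι k)} {u v : ι →₀ ℕ} {i j : ι}
    (hu : u i ≠ 0) (hi : X i ∈ G) (hv : v j ≠ 0) (hj : X j ∈ G) :
    binomial k u v ∈ Ideal.span G :=
  Ideal.sub_mem _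
    (Ideal.mem_of_dvd _ (X_dvd_monomial.2 (Or.inr hu)) (Ideal.subset_span hi))
    (Ideal.mem_of_dvd _ (X_dvd_monomial.2 (Or.inr hv)) (Ideal.subset_span hj))

theorem not_isCompleteIntersection_of_four_arith [Fintype ι] {w : ι → ℕ} (hw : ∀ i, 0 < w i)
    (hmin : ∀ i, ∀ u : ι →₀ ℕ, Finsupp.weight w u = w i → u = Finsupp.single i 1)
    (a : Fin 4 ↪ ι) {h e : ℕ} (h1 : w (a 1) = h * w (a 0) + e)
    (h2 : w (a 2) = h * w (a 0) + 2 * e) (h3 : w (a 3) = h * w (a 0) + 3 * e) :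
    ¬ IsCompleteIntersection (toricIdeal k w) := by
  classical
  intro hCI
  let q₁ := binomial k (exponent a ![0, 2, 0, 0]) (exponent a ![h, 0, 1, 0])
  let q₂ := binomial k (exponent a ![0, 1, 1, 0]) (exponent a ![h, 0, 0, 1])
  let q₃ := binomial k (exponent a ![0, 0, 2, 0]) (exponent a ![0, 1, 0, 1])
  have hc11 : coeff (exponent a ![0, 2, 0, 0]) q₁ ≠ 0 := by
    simp [q₁, coeff_exponent_binomial]
  have hc12 : coeff (exponent a ![0, 2, 0, 0]) q₂ = 0 := by
    simp [q₂, coeff_exponent_binomial]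
  have hc13 : coeff (exponent a ![0, 2, 0, 0]) q₃ = 0 := by
    simp [q₃, coeff_exponent_binomial]
  have hc21 : coeff (exponent a ![0, 1, 1, 0]) q₁ = 0 := by
    simp [q₁, coeff_exponent_binomial]
  have hc22 : coeff (exponent a ![0, 1, 1, 0]) q₂ ≠ 0 := by
    simp [q₂, coeff_exponent_binomial]
  have hc23 : coeff (exponent a ![0, 1, 1, 0]) q₃ = 0 := by
    simp [q₃, coeff_exponent_binomial]
  have hc31 : coeff (exponent a ![0, 0, 2, 0]) q₁ = 0 := by
    simp [q₁, coeff_exponent_binomial]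
  have hc32 : coeff (exponent a ![0, 0, 2, 0]) q₂ = 0 := by
    simp [q₂, coeff_exponent_binomial]
  have hc33 : coeff (exponent a ![0, 0, 2, 0]) q₃ ≠ 0 := by
    simp [q₃, coeff_exponent_binomial]
  have h12 : q₁ ≠ q₂ := fun h => hc11 (h ▸ hc12)
  have h13 : q₁ ≠ q₃ := fun h => hc11 (h ▸ hc13)
  have h23 : q₂ ≠ q₃ := fun h => hc22 (h ▸ hc23)
  let Q : Finset (MvPolynomial ι k) := {q₁, q₂, q₃}
  have hQcard : Q.card = 3 := Finset.card_eq_three.2 ⟨_, _, _, h12, h13, h23, rfl⟩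
  obtain ⟨B, hQB, hBcard, hB, hI⟩ := exists_binomial_extension (k := k) hw hmin (Q := Q) (by
    have key : ∀ f g : Fin 4 → ℕ, (∀ j, f j = 0 ∨ g j = 0) → f ≠ g →
        f 0 * w (a 0) + f 1 * w (a 1) + f 2 * w (a 2) + f 3 * w (a 3) =
          g 0 * w (a 0) + g 1 * w (a 1) + g 2 * w (a 2) + g 3 * w (a 3) →
        ∃ u v : ι →₀ ℕ, Finsupp.weight w u = Finsupp.weight w v ∧ u ≠ v ∧
          (∀ i, u i = 0 ∨ v i = 0) ∧
          binomial k (exponent a f) (exponent a g) = binomial k u v := fun f g hfg hne hwt =>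
      ⟨_, _, by rw [weight_exponent, weight_exponent, hwt], (exponent_injective a).ne hne,
        exponent_eq_zero_or hfg, rfl⟩
    intro q hq
    simp only [Q, Finset.coe_insert, Finset.coe_singleton, Set.mem_insert_iff,
      Set.mem_singleton_iff] at hq
    rcases hq with rfl | rfl | rfl
    · exact key _ _ (by simp [Fin.forall_fin_succ]) (by simp) (by simp [h1, h2]; ring)
    · exact key _ _ (by simp [Fin.forall_fin_succ]) (by simp) (by simp [h1, h2, h3]; ring)
    · exact key _ _ (by simp [Fin.forall_fin_succ]) (by simp) (by simp [h1, h2, h3]; ring))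
    (by
    intro q hq
    simp only [Q, Finset.coe_insert, Finset.coe_singleton, Set.mem_insert_iff,
      Set.mem_singleton_iff] at hq
    simp only [Q, Finset.coe_insert, Finset.coe_singleton, Set.mem_insert_iff,
      Set.mem_singleton_iff, forall_eq_or_imp, forall_eq]
    rcases hq with rfl | rfl | rfl
    · exact ⟨_, by rw [degree_exponent]; simp, hc11, fun h => absurd rfl h, fun _ => hc12,
        fun _ => hc13⟩
    · exact ⟨_, by rw [degree_exponent]; simp, hc22, fun _ => hc21, fun h => absurd rfl h,
        fun _ => hc23⟩
    · exact ⟨_, by rw [degree_exponent]; simp, hc33, fun _ => hc31, fun _ => hc32,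
        fun h => absurd rfl h⟩)
  have hQB' : Q ⊆ B := by exact_mod_cast hQB
  -- The three quadrics are traded for three variables, one of which divides each of their six
  -- monomials.
  let G : Finset (MvPolynomial ι k) := {X (a 1), X (a 2), X (a 3)} ∪ (B \ Q)
  refine X_notMem_of_toricIdeal_le_span_sup_mul (k := k) (w := w) (G := G) ?_ ?_ ?_ (a 1)
    (by simp [G])
  · have hG : G.card ≤ B.card := by
      refine (Finset.card_union_le _ _).trans ?_
      have h4 : ({X (a 1), X (a 2), X (a 3)} : Finset (MvPolynomial ι k)).card ≤ 3 :=
        Finset.card_le_three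
      have h5 := Finset.card_sdiff_add_card_eq_card hQB'
      omega
    rw [← hCI]
    exact_mod_cast hG.trans hBcard
  · intro g hg
    simp only [G, Finset.mem_union, Finset.mem_insert, Finset.mem_singleton,
      Finset.mem_sdiff] at hg
    rcases hg with (rfl | rfl | rfl) | ⟨hg, -⟩
    · exact X_mem_irrelevant _
    · exact X_mem_irrelevant _
    · exact X_mem_irrelevant _
    · obtain ⟨u, v, huv, -, -, rfl⟩ := hB g hg
      exact binomial_mem_irrelevant hw huv
  · refine hI.trans (sup_le_sup_right (Ideal.span_le.2 fun b hb => ?_) _)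
    by_cases hbQ : b ∈ Q
    · have m1 : (X (a 1) : MvPolynomial ι k) ∈ (G : Set (MvPolynomial ι k)) := by simp [G]
      have m2 : (X (a 2) : MvPolynomial ι k) ∈ (G : Set (MvPolynomial ι k)) := by simp [G]
      have m3 : (X (a 3) : MvPolynomial ι k) ∈ (G : Set (MvPolynomial ι k)) := by simp [G]
      simp only [Q, Finset.mem_insert, Finset.mem_singleton] at hbQ
      rcases hbQ with rfl | rfl | rfl
      · exact binomial_mem_span_of_X_mem (by simp) m1 (by simp) m2
      · exact binomial_mem_span_of_X_mem (by simp) m1 (by simp) m3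
      · exact binomial_mem_span_of_X_mem (by simp) m2 (by simp) m1
    · exact Ideal.subset_span (by simp [G, hbQ, Finset.mem_coe.1 hb])

/-- The exponents `u` and `v` both involve an index of `S`. -/
def Splits {α : Type*} (u v : α → ℕ) (S : Finset α) : Prop :=
  (∃ i ∈ S, u i ≠ 0) ∧ ∃ i ∈ S, v i ≠ 0

/-- Two binomials `x ^ u - x ^ v` and `x ^ u' - x ^ v'` of degree zero which form, together with
`x₁ ^ 2 - x₀ ^ h * x₂`, a mixed dominating basis of the lattice of relations of `d`. -/
structure IsMixedDominating (d : Fin 4 → ℕ) (h : ℕ) (u v u' v' : Fin 4 → ℕ) : Prop where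
  deg : u 0 * d 0 + u 1 * d 1 + u 2 * d 2 + u 3 * d 3 =
    v 0 * d 0 + v 1 * d 1 + v 2 * d 2 + v 3 * d 3
  deg' : u' 0 * d 0 + u' 1 * d 1 + u' 2 * d 2 + u' 3 * d 3 =
    v' 0 * d 0 + v' 1 * d 1 + v' 2 * d 2 + v' 3 * d 3
  ne : u ≠ v
  ne' : u' ≠ v'
  disjoint : ∀ i, u i = 0 ∨ v i = 0
  disjoint' : ∀ i, u' i = 0 ∨ v' i = 0
  basis : ∀ z : Fin 4 → ℤ, z 0 * d 0 + z 1 * d 1 + z 2 * d 2 + z 3 * d 3 = 0 →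
    ∃ a b c : ℤ, ∀ i, z i = a * (![-h, 2, -1, 0] : Fin 4 → ℤ) i + b * (u i - v i) +
      c * (u' i - v' i)
  not_splits : ∀ S : Finset (Fin 4), S = {0, 1} ∨ S = {1, 2} → ¬ Splits u v S
  not_splits' : ∀ S : Finset (Fin 4), S = {0, 1} ∨ S = {1, 2} → ¬ Splits u' v' S
  not_splits_both : ∀ S : Finset (Fin 4), S.Nonempty →
    (S.card ≤ 2 ∨ S = {0, 1, 2} ∨ S = {0, 1, 3} ∨ S = {1, 2, 3}) →
      ¬ (Splits u v S ∧ Splits u' v' S)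

/-- Repetitions among q, f, g are allowed, so a smaller set of generators needs no separate
treatment. -/
theorem exists_of_card_le_three {α : Type*} {B : Finset α} (hB : B.card ≤ 3) {q : α} (hq : q ∈ B) :
    ∃ f g, f ∈ B ∧ g ∈ B ∧ ∀ b ∈ B, b = q ∨ b = f ∨ b = g := by
  classical
  by_cases h1 : ∃ f ∈ B, f ≠ q
  · obtain ⟨f, hf, hfq⟩ := h1
    by_cases h2 : ∃ g ∈ B, g ≠ q ∧ g ≠ f
    · obtain ⟨g, hg, hgq, hgf⟩ := h2
      refine ⟨f, g, hf, hg, fun b hb => ?_⟩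
      have hsub : ({q, f, g} : Finset α) ⊆ B := by
        simp [Finset.insert_subset_iff, hq, hf, hg]
      have hcard : ({q, f, g} : Finset α).card = 3 :=
        Finset.card_eq_three.2 ⟨_, _, _, hfq.symm, hgq.symm, hgf.symm, rfl⟩
      have heq := Finset.eq_of_subset_of_card_le hsub (by rw [hcard]; exact hB)
      simpa [← heq] using hb
    · push Not at h2
      exact ⟨f, f, hf, hf, fun b hb => by
        by_cases hbq : b = q
        · exact Or.inl hbq
        · exact Or.inr (Or.inl (h2 b hb hbq))⟩
  · push Not at h1
    exact ⟨q, q, hq, hq, fun b hb => Or.inl (h1 b hb)⟩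

/-- The quadric is completed to at most three binomials generating modulo m I. Their exponent
differences span the lattice, and each forbidden splitting is an exchange that would put a variable
into the toric ideal. -/
theorem exists_isMixedDominating [Fintype ι] {w : ι → ℕ} (hw : ∀ i, 0 < w i)
    (hmin : ∀ i, ∀ u : ι →₀ ℕ, Finsupp.weight w u = w i → u = Finsupp.single i 1)
    (e : Fin 4 ≃ ι) {d : Fin 4 → ℕ} (hd : ∀ j, w (e j) = d j) {h : ℕ} (hh : 0 < h)
    (hrel : 2 * d 1 = h * d 0 + d 2) (hCI : IsCompleteIntersection (toricIdeal k w)) :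
    ∃ u v u' v', IsMixedDominating d h u v u' v' := by
  classical
  have hwt := fun u => (weight_eq_sum_fin_four w e u).trans (by rw [hd, hd, hd, hd])
  have hht := height_toricIdeal_eq_three (k := k) hw
    (by rw [← Fintype.card_congr e, Fintype.card_fin])
  set U := exponent e.toEmbedding ![0, 2, 0, 0] with hU
  set V := exponent e.toEmbedding ![h, 0, 1, 0] with hV
  have hUV : Finsupp.weight w U = Finsupp.weight w V := by
    rw [hwt, hwt]; simp [U, V, hrel]
  obtain ⟨B, hQB, hBcard, hB, hI⟩ := exists_binomial_extension (k := k) hw hmin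
    (Q := {binomial k U V}) (by
      rintro _ rfl
      exact ⟨U, V, hUV, (exponent_injective _).ne (by simp),
        exponent_eq_zero_or (by simp [Fin.forall_fin_succ]), rfl⟩) (by
      rintro _ rfl
      refine ⟨U, by rw [hU, degree_exponent]; simp, ?_, fun q' hq' hne => absurd hq' hne⟩
      rw [hU, hV, coeff_exponent_binomial]
      simp)
  have hB3 : B.card ≤ 3 := by
    have : (B.card : ℕ∞) ≤ 3 := by
      rw [← hht, ← hCI]
      exact_mod_cast hBcard
    exact_mod_cast this
  have hq : binomial k U V ∈ B := by exact_mod_cast hQB rfl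
  -- The binomials outside O are traded for the variables indexed by S.
  have hno : ∀ (S : Finset (Fin 4)) (O : Finset (MvPolynomial ι k)), S.Nonempty →
      S.card + O.card ≤ 3 → O ⊆ B →
      (∀ b ∈ B, b ∈ O ∨ ∃ u v : ι →₀ ℕ, b = binomial k u v ∧ Splits (u ∘ e) (v ∘ e) S) →
      False := by
    rintro S O ⟨j, hj⟩ hcard hO hb
    let G : Finset (MvPolynomial ι k) := S.image (fun j => X (e j)) ∪ O
    have hX : ∀ j ∈ S, (X (e j) : MvPolynomial ι k) ∈ (G : Set (MvPolynomial ι k)) := by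
      intro j hj
      exact Finset.mem_union_left _ (Finset.mem_image_of_mem _ hj)
    refine X_notMem_of_toricIdeal_le_span_sup_mul (k := k) (w := w) (G := G) ?_ ?_ ?_ (e j)
      (hX j hj)
    · rw [hht]
      have : G.card ≤ 3 :=
        (Finset.card_union_le _ _).trans ((Nat.add_le_add_right Finset.card_image_le _).trans hcard)
      exact_mod_cast this
    · intro g hg
      rcases Finset.mem_union.1 hg with hg | hg
      · obtain ⟨l, -, rfl⟩ := Finset.mem_image.1 hg
        exact X_mem_irrelevant _
      · obtain ⟨u, v, huv, -, -, rfl⟩ := hB g (hO hg)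
        exact binomial_mem_irrelevant hw huv
    · refine hI.trans (sup_le_sup_right (Ideal.span_le.2 fun b hb' => ?_) _)
      rcases hb b hb' with h | ⟨u, v, rfl, ⟨i, hi, hui⟩, l, hl, hvl⟩
      · exact Ideal.subset_span (Finset.mem_union_right _ h)
      · exact binomial_mem_span_of_X_mem hui (hX i hi) hvl (hX l hl)
  obtain ⟨f, g, hf, hg, hBfg⟩ := exists_of_card_le_three hB3 hq
  obtain ⟨u, v, huv, hne, hdisj, rfl⟩ := hB f hf
  obtain ⟨u', v', huv', hne', hdisj', rfl⟩ := hB g hg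
  have hqs : ∀ S : Finset (Fin 4), 1 ∈ S → (0 ∈ S ∨ 2 ∈ S) → Splits (U ∘ e) (V ∘ e) S := by
    intro S h1 h02
    refine ⟨⟨1, h1, by simp [U]⟩, ?_⟩
    rcases h02 with h0 | h2
    · exact ⟨0, h0, by simp [V, hh.ne']⟩
    · exact ⟨2, h2, by simp [V]⟩
  have hcomp : ∀ {u v : ι →₀ ℕ}, u ≠ v → u ∘ e ≠ v ∘ e := fun hne h =>
    hne (DFunLike.coe_injective (e.surjective.injective_comp_right h))
  refine ⟨u ∘ e, v ∘ e, u' ∘ e, v' ∘ e, ?_, ?_, hcomp hne, hcomp hne', fun i => hdisj _,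
    fun i => hdisj' _, ?_, ?_, ?_, ?_⟩
  · rw [hwt, hwt] at huv; exact huv
  · rw [hwt, hwt] at huv'; exact huv'
  · intro z hz
    let δ : Fin 4 → ℤ := fun i => u (e i) - v (e i)
    let δ' : Fin 4 → ℤ := fun i => u' (e i) - v' (e i)
    let L : Submodule ℤ (Fin 4 → ℤ) := Submodule.span ℤ {![-(h : ℤ), 2, -1, 0], δ, δ'}
    let cls : (ι →₀ ℕ) →+ (Fin 4 → ℤ) ⧸ L :=
      { toFun := fun y => L.mkQ fun i => (y (e i) : ℤ)
        map_zero' := by simp only [Finsupp.coe_zero, Pi.zero_apply, Nat.cast_zero]; exact map_zero L.mkQ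
        map_add' := fun x y =>
          (congrArg L.mkQ (by ext i; simp)).trans (map_add L.mkQ _ _) }
    have hcls : ∀ x y : ι →₀ ℕ, cls x = cls y ↔ (fun i => (x (e i) : ℤ) - y (e i)) ∈ L :=
      fun x y => Submodule.Quotient.eq L
    have hmem : ∀ x y : ι →₀ ℕ, Finsupp.weight w x = Finsupp.weight w y → cls x = cls y := by
      intro x y hxy
      refine map_eq_of_toricIdeal_le_span_sup_mul hw cls (B := (B : Set (MvPolynomial ι k)))
        (fun b hb => ?_) hI hxy
      rcases hBfg b hb with rfl | rfl | rfl
      · refine ⟨U, V, hUV, ?_, rfl⟩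
        rw [hcls]
        refine Submodule.subset_span (Or.inl ?_)
        ext i
        fin_cases i <;> simp [U, V]
      · exact ⟨u, v, huv, (hcls u v).2 (Submodule.subset_span (by simp [δ])), rfl⟩
      · exact ⟨u', v', huv', (hcls u' v').2 (Submodule.subset_span (by simp [δ'])), rfl⟩
    -- An integer relation is the difference of its positive and negative parts, two exponents of
    -- equal weight.
    have h1 := hmem (exponent e.toEmbedding fun i => (z i).toNat)
      (exponent e.toEmbedding fun i => (-z i).toNat) (by
        rw [hwt, hwt]
        simp only [exponent_toEmbedding_apply]
        zify
        have := fun i => Int.toNat_sub_toNat_neg (z i)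
        linear_combination hz + (d 0 : ℤ) * this 0 + (d 1 : ℤ) * this 1 + (d 2 : ℤ) * this 2 +
          (d 3 : ℤ) * this 3)
    rw [hcls] at h1
    simp only [exponent_toEmbedding_apply, Int.toNat_sub_toNat_neg] at h1
    obtain ⟨a, b, c, habc⟩ := Submodule.mem_span_triple.1 h1
    refine ⟨a, b, c, fun i => ?_⟩
    have h2 := congrFun habc i
    simp only [Pi.add_apply, Pi.smul_apply, smul_eq_mul, δ, δ'] at h2
    exact h2.symm
  · intro S hS hsp
    refine hno S {binomial k u' v'} (by rcases hS with rfl | rfl <;> simp)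
      (by rcases hS with rfl | rfl <;> simp) (by simpa using hg) fun b hb => ?_
    rcases hBfg b hb with rfl | rfl | rfl
    · exact Or.inr ⟨U, V, rfl, hqs S (by rcases hS with rfl | rfl <;> simp)
        (by rcases hS with rfl | rfl <;> simp)⟩
    · exact Or.inr ⟨u, v, rfl, hsp⟩
    · exact Or.inl (by simp)
  · intro S hS hsp
    refine hno S {binomial k u v} (by rcases hS with rfl | rfl <;> simp)
      (by rcases hS with rfl | rfl <;> simp) (by simpa using hf) fun b hb => ?_
    rcases hBfg b hb with rfl | rfl | rfl
    · exact Or.inr ⟨U, V, rfl, hqs S (by rcases hS with rfl | rfl <;> simp)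
        (by rcases hS with rfl | rfl <;> simp)⟩
    · exact Or.inl (by simp)
    · exact Or.inr ⟨u', v', rfl, hsp⟩
  · rintro S hSne hS ⟨hsp, hsp'⟩
    -- Two variables at most: the quadric is kept and the other two are traded. Three variables: the
    -- listed sets also split the quadric, so all three binomials are traded.
    rcases hS with hS | hS
    · refine hno S {binomial k U V} hSne (by rw [Finset.card_singleton]; omega) (by simpa using hq) fun b hb => ?_
      rcases hBfg b hb with rfl | rfl | rfl
      · exact Or.inl (by simp)
      · exact Or.inr ⟨u, v, rfl, hsp⟩
      · exact Or.inr ⟨u', v', rfl, hsp'⟩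
    · refine hno S ∅ hSne (by rcases hS with rfl | rfl | rfl <;> simp) (by simp) fun b hb => ?_
      rcases hBfg b hb with rfl | rfl | rfl
      · exact Or.inr ⟨U, V, rfl, hqs S (by rcases hS with rfl | rfl | rfl <;> simp)
          (by rcases hS with rfl | rfl | rfl <;> simp)⟩
      · exact Or.inr ⟨u, v, rfl, hsp⟩
      · exact Or.inr ⟨u', v', rfl, hsp'⟩

end Necessity

/-! ### From mixed dominating bases to the two gluing conditions. -/

section Arithmetic

variable {d : Fin 4 → ℕ} {h : ℕ} {u v u' v' : Fin 4 → ℕ}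

theorem IsMixedDominating.symm_left (H : IsMixedDominating d h u v u' v') :
    IsMixedDominating d h v u u' v' where
  deg := H.deg.symm
  deg' := H.deg'
  ne := H.ne.symm
  ne' := H.ne'
  disjoint i := (H.disjoint i).symm
  disjoint' := H.disjoint'
  basis z hz := by
    obtain ⟨a, b, c, habc⟩ := H.basis z hz
    exact ⟨a, -b, c, fun i => by rw [habc]; ring⟩
  not_splits S hS h := H.not_splits S hS h.symm
  not_splits' := H.not_splits'
  not_splits_both S hS hS' h := H.not_splits_both S hS hS' ⟨h.1.symm, h.2⟩

theorem IsMixedDominating.swap (H : IsMixedDominating d h u v u' v') :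
    IsMixedDominating d h u' v' u v where
  deg := H.deg'
  deg' := H.deg
  ne := H.ne'
  ne' := H.ne
  disjoint := H.disjoint'
  disjoint' := H.disjoint
  basis z hz := by
    obtain ⟨a, b, c, habc⟩ := H.basis z hz
    exact ⟨a, c, b, fun i => by rw [habc]; ring⟩
  not_splits := H.not_splits'
  not_splits' := H.not_splits
  not_splits_both S hS hS' h := H.not_splits_both S hS hS' h.symm

theorem IsMixedDominating.symm_right (H : IsMixedDominating d h u v u' v') :
    IsMixedDominating d h u v v' u' :=
  H.swap.symm_left.swap

/-- The relation `u - v` involves index `3` alone on one side. -/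
def IsolatesLast (u v : Fin 4 → ℕ) : Prop :=
  u 3 = 0 ∧ v 0 = 0 ∧ v 1 = 0 ∧ v 2 = 0 ∧ v 3 ≠ 0

/-- The relation `u - v` separates the indices `0` and `2` and does not involve index `1`. -/
def SeparatesZeroTwo (u v : Fin 4 → ℕ) : Prop :=
  u 0 ≠ 0 ∧ u 1 = 0 ∧ u 2 = 0 ∧ v 0 = 0 ∧ v 1 = 0 ∧ v 2 ≠ 0

theorem exists_ne_zero_of_deg (hd : ∀ i, 0 < d i)
    (hdeg : u 0 * d 0 + u 1 * d 1 + u 2 * d 2 + u 3 * d 3 =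
      v 0 * d 0 + v 1 * d 1 + v 2 * d 2 + v 3 * d 3) (hne : u ≠ v) :
    v 0 ≠ 0 ∨ v 1 ≠ 0 ∨ v 2 ≠ 0 ∨ v 3 ≠ 0 := by
  by_contra hv
  push Not at hv
  obtain ⟨h0, h1, h2, h3⟩ := hv
  apply hne
  have hd' := fun i => (hd i).ne'
  simp only [h0, h1, h2, h3, zero_mul, add_zero, Nat.add_eq_zero_iff, mul_eq_zero, hd',
    or_false] at hdeg
  ext i
  fin_cases i <;> simp [*]

/-- On each of {0, 1} and {1, 2} one side vanishes. If the same side vanishes on both, it is a pure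
power of the last variable; otherwise index 1 is absent and 0, 2 lie on opposite sides. -/
theorem IsMixedDominating.pattern (hd : ∀ i, 0 < d i) (H : IsMixedDominating d h u v u' v') :
    IsolatesLast u v ∨ IsolatesLast v u ∨ SeparatesZeroTwo u v ∨ SeparatesZeroTwo v u := by
  have h1 := exists_ne_zero_of_deg hd H.deg H.ne
  have h2 := exists_ne_zero_of_deg hd H.deg.symm H.ne.symm
  have h3 := H.not_splits {0, 1} (Or.inl rfl)
  have h4 := H.not_splits {1, 2} (Or.inr rfl)
  have d0 := H.disjoint 0
  have d1 := H.disjoint 1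
  have d2 := H.disjoint 2
  have d3 := H.disjoint 3
  simp only [Splits, Finset.mem_insert, Finset.mem_singleton, exists_eq_or_imp, exists_eq_left]
    at h3 h4
  unfold IsolatesLast SeparatesZeroTwo
  omega

/-- The conclusion of the classification for four generators. -/
def GluingCondition (d : Fin 4 → ℕ) : Prop :=
  (Even (d 0 / Nat.gcd (d 0) (d 1)) ∧
    Nat.gcd (d 0) (d 1) * d 3 ∈ AddSubmonoid.closure ({d 0, d 1, d 2} : Set ℕ)) ∨
  (Even (d 0) ∧ Even (d 3) ∧ IsReduction {d 0, d 2, d 3} ∅)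

theorem IsMixedDominating.gluing_of_isolates_separates (hd : ∀ i, 0 < d i)
    (H : IsMixedDominating d h u v u' v') (A : IsolatesLast u v)
    (C : SeparatesZeroTwo u' v') (hu3 : u' 3 = 0) (hv3 : v' 3 = 0) : GluingCondition d := by
  left
  obtain ⟨a3, b0, b1, b2, b3⟩ := A
  obtain ⟨c0, c1, c2, e0, e1, e2⟩ := C
  have hdeg := H.deg
  rw [a3, b0, b1, b2] at hdeg
  set g := Nat.gcd (d 0) (d 1) with hg
  have hgpos : 0 < g := Nat.gcd_pos_of_pos_left _ (hd 0)
  constructor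
  · obtain ⟨s, hs⟩ : g ∣ d 0 := Nat.gcd_dvd_left _ _
    obtain ⟨t, ht⟩ : g ∣ d 1 := Nat.gcd_dvd_right _ _
    -- Only the relation u - v involves index 3, so its coefficient here is zero; then only the
    -- quadric contributes at index 1, where it has the entry 2.
    obtain ⟨a, b, c, habc⟩ := H.basis ![(t : ℤ), -(s : ℤ), 0, 0] (by
      rw [hs, ht]; simp; ring)
    have h1 := habc 1
    have h3 := habc 3
    simp [a3, b3, hu3, hv3] at h3
    simp [h3, c1, e1] at h1
    rw [hs, Nat.mul_div_cancel_left _ hgpos]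
    rw [Nat.even_iff]
    omega
  · obtain ⟨a, b, c, habc⟩ := H.basis
      ![d 3 * Nat.gcdA (d 0) (d 1), d 3 * Nat.gcdB (d 0) (d 1), 0, -(g : ℤ)] (by
        have := Nat.gcd_eq_gcd_ab (d 0) (d 1)
        rw [← hg] at this
        simp
        rw [this]; ring)
    have h3 := habc 3
    simp [a3, hu3, hv3] at h3
    have hdvd : v 3 ∣ g := Int.natCast_dvd_natCast.1 ⟨b, by rw [h3]; ring⟩
    obtain ⟨m, hm⟩ := hdvd
    have : g * d 3 = m • (u 0 • d 0 + u 1 • d 1 + u 2 • d 2) := by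
      simp only [smul_eq_mul]
      rw [hm]
      simp only [zero_mul, zero_add, add_zero] at hdeg
      rw [hdeg]; ring
    rw [this]
    have hsub := AddSubmonoid.subset_closure (s := ({d 0, d 1, d 2} : Set ℕ))
    exact nsmul_mem (add_mem (add_mem (nsmul_mem (hsub (by simp)) _)
      (nsmul_mem (hsub (by simp)) _)) (nsmul_mem (hsub (by simp)) _)) _

/-- Index 1 occurs only in the quadric, with entry 2, so every relation has an even entry there. -/
theorem IsMixedDominating.even (H : IsMixedDominating d h u v u' v') (hu : u 1 = 0)
    (hv : v 1 = 0) (hu' : u' 1 = 0) (hv' : v' 1 = 0) : Even (d 0) ∧ Even (d 3) := by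
  constructor
  · obtain ⟨a, b, c, habc⟩ := H.basis ![(d 1 : ℤ), -(d 0 : ℤ), 0, 0] (by simp; ring)
    have h1 := habc 1
    simp [hu, hv, hu', hv'] at h1
    rw [Nat.even_iff]
    omega
  · obtain ⟨a, b, c, habc⟩ := H.basis ![0, -(d 3 : ℤ), 0, (d 1 : ℤ)] (by simp; ring)
    have h1 := habc 1
    simp [hu, hv, hu', hv'] at h1
    rw [Nat.even_iff]
    omega

theorem IsMixedDominating.gluing (hd : ∀ i, 0 < d i) (hinj : Function.Injective d)
    (H : IsMixedDominating d h u v u' v') : GluingCondition d := by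
  have h02 : d 0 ≠ d 2 := hinj.ne (by decide)
  have h03 : d 0 ≠ d 3 := hinj.ne (by decide)
  have h23 : d 2 ≠ d 3 := hinj.ne (by decide)
  -- the pure power of the variable `0` or of the variable `2` is isolated
  have hzero : ∀ {u v u' v' : Fin 4 → ℕ}, IsMixedDominating d h u v u' v' → u 0 ≠ 0 → u 1 = 0 →
      u 2 = 0 → u 3 = 0 → v 0 = 0 → v 1 = 0 → u' 0 = 0 → u' 1 = 0 → v' 0 = 0 → v' 1 = 0 →
      GluingCondition d := by
    intro u v u' v' H u0 u1 u2 u3 v0 v1 u0' u1' v0' v1'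
    obtain ⟨he0, he3⟩ := H.even u1 v1 u1' v1'
    refine Or.inr ⟨he0, he3, ?_⟩
    have hdeg := H.deg
    simp only [u1, u2, u3, v0, v1, zero_mul, add_zero, zero_add] at hdeg
    refine isReduction_triple (hd 2) (hd 3) h02 h03 h23 (Nat.pos_of_ne_zero u0) hdeg
      fun m x y hm => ?_
    -- The zero at index 1 removes the quadric, leaving one basis vector with a nonzero entry at
    -- index 0; hence u 0 is the least multiplier of d 0.
    obtain ⟨a, b, c, habc⟩ := H.basis ![m, 0, -x, -y] (by simp; linear_combination hm)
    have h0 := habc 0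
    have h1 := habc 1
    simp [u1, v1, u1', v1'] at h1
    simp [h1, v0, u0', v0'] at h0
    exact ⟨b, by rw [h0]; ring⟩
  have htwo : ∀ {u v u' v' : Fin 4 → ℕ}, IsMixedDominating d h u v u' v' → u 2 ≠ 0 → u 0 = 0 →
      u 1 = 0 → u 3 = 0 → v 1 = 0 → v 2 = 0 → u' 1 = 0 → u' 2 = 0 → v' 1 = 0 → v' 2 = 0 →
      GluingCondition d := by
    intro u v u' v' H u2 u0 u1 u3 v1 v2 u1' u2' v1' v2'
    obtain ⟨he0, he3⟩ := H.even u1 v1 u1' v1'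
    refine Or.inr ⟨he0, he3, ?_⟩
    have hdeg := H.deg
    simp only [u0, u1, u3, v1, v2, zero_mul, add_zero, zero_add] at hdeg
    rw [Finset.insert_comm]
    refine isReduction_triple (hd 0) (hd 3) h02.symm h23 h03 (Nat.pos_of_ne_zero u2) hdeg
      fun m x y hm => ?_
    obtain ⟨a, b, c, habc⟩ := H.basis ![-x, 0, m, -y] (by simp; linear_combination hm)
    have h1 := habc 1
    have h2 := habc 2
    simp [u1, v1, u1', v1'] at h1
    simp [h1, v2, u2', v2'] at h2
    exact ⟨b, by rw [h2]; ring⟩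
  -- both relations isolate the last variable
  have hAA : ∀ {u v u' v' : Fin 4 → ℕ}, IsMixedDominating d h u v u' v' → IsolatesLast u v →
      IsolatesLast u' v' → GluingCondition d := by
    intro u v u' v' H A A'
    have n1 := exists_ne_zero_of_deg hd H.deg.symm H.ne.symm
    have n2 := exists_ne_zero_of_deg hd H.deg'.symm H.ne'.symm
    have s1 := H.not_splits_both {0, 1, 3} (by simp) (by simp)
    have s2 := H.not_splits_both {1, 2, 3} (by simp) (by simp)
    simp only [Splits, Finset.mem_insert, Finset.mem_singleton, exists_eq_or_imp, exists_eq_left]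
      at s1 s2
    obtain ⟨a3, b0, b1, b2, b3⟩ := A
    obtain ⟨a3', b0', b1', b2', b3'⟩ := A'
    -- The two forbidden splittings force one relation to equate powers of variables 0 and 3 and the
    -- other powers of variables 2 and 3.
    by_cases h0 : u 0 = 0
    · exact htwo H (by omega) h0 (by omega) a3 b1 b2 (by omega) (by omega) b1' b2'
    · exact hzero H h0 (by omega) (by omega) a3 b0 b1 (by omega) (by omega) b0' b1'
  have hAC : ∀ {u v u' v' : Fin 4 → ℕ}, IsMixedDominating d h u v u' v' → IsolatesLast u v →
      SeparatesZeroTwo u' v' → GluingCondition d := by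
    intro u v u' v' H A C
    by_cases hu3 : u' 3 = 0
    · by_cases hv3 : v' 3 = 0
      · exact H.gluing_of_isolates_separates hd A C hu3 hv3
      -- The separating relation splits {0, 1, 3}, so the isolating one cannot and has only variable
      -- 2 opposite variable 3.
      · have s1 := H.not_splits_both {0, 1, 3} (by simp) (by simp)
        simp only [Splits, Finset.mem_insert, Finset.mem_singleton, exists_eq_or_imp,
          exists_eq_left] at s1
        obtain ⟨a3, b0, b1, b2, b3⟩ := A
        obtain ⟨c0, c1, c2, e0, e1, e2⟩ := C
        exact hzero H.swap c0 c1 c2 hu3 e0 e1 (by omega) (by omega) b0 b1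
    · have s2 := H.not_splits_both {1, 2, 3} (by simp) (by simp)
      have hv3 := (H.disjoint' 3).resolve_left hu3
      simp only [Splits, Finset.mem_insert, Finset.mem_singleton, exists_eq_or_imp,
        exists_eq_left] at s2
      obtain ⟨a3, b0, b1, b2, b3⟩ := A
      obtain ⟨c0, c1, c2, e0, e1, e2⟩ := C
      exact htwo H.swap.symm_left e2 e0 e1 hv3 c1 c2 (by omega) (by omega) b1 b2
  have hCC : ∀ {u v u' v' : Fin 4 → ℕ}, IsMixedDominating d h u v u' v' → SeparatesZeroTwo u v →
      SeparatesZeroTwo u' v' → GluingCondition d := by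
    intro u v u' v' H C C'
    refine absurd ⟨⟨⟨0, ?_, C.1⟩, 2, ?_, C.2.2.2.2.2⟩, ⟨0, ?_, C'.1⟩, 2, ?_, C'.2.2.2.2.2⟩
      (H.not_splits_both {0, 2} (by simp) (Or.inl (by simp))) <;> simp
  have hA : ∀ {u v u' v' : Fin 4 → ℕ}, IsMixedDominating d h u v u' v' → IsolatesLast u v →
      GluingCondition d := by
    intro u v u' v' H A
    rcases H.swap.pattern hd with B | B | B | B
    · exact hAA H A B
    · exact hAA H.symm_right A B
    · exact hAC H A B
    · exact hAC H.symm_right A B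
  have hC : ∀ {u v u' v' : Fin 4 → ℕ}, IsMixedDominating d h u v u' v' → SeparatesZeroTwo u v →
      GluingCondition d := by
    intro u v u' v' H C
    rcases H.swap.pattern hd with B | B | B | B
    · exact hAC H.swap B C
    · exact hAC H.symm_right.swap B C
    · exact hCC H C B
    · exact hCC H.symm_right C B
  rcases H.pattern hd with B | B | B | B
  · exact hA H B
  · exact hA H.symm_left B
  · exact hC H B
  · exact hC H.symm_left B

end Arithmetic

/-! ### Sufficiency of the two conditions and the final assembly. -/

theorem mem_closure_triple_iff {a b c n : ℕ} :
    n ∈ AddSubmonoid.closure ({a, b, c} : Set ℕ) ↔ ∃ x y z : ℕ, n = x * a + y * b + z * c := by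
  rw [Set.insert_eq, AddSubmonoid.closure_union, AddSubmonoid.mem_sup]
  constructor
  · rintro ⟨m, hm, l, hl, rfl⟩
    obtain ⟨x, rfl⟩ := AddSubmonoid.mem_closure_singleton.1 hm
    obtain ⟨y, z, rfl⟩ := mem_closure_pair_iff.1 hl
    exact ⟨x, y, z, by rw [smul_eq_mul, add_assoc]⟩
  · rintro ⟨x, y, z, rfl⟩
    exact ⟨x * a, AddSubmonoid.mem_closure_singleton.2 ⟨x, rfl⟩, y * b + z * c,
      mem_closure_pair_iff.2 ⟨y, z, rfl⟩, by rw [add_assoc]⟩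

theorem exists_equiv_Icc {a b c e : ℕ} (ha : a ∈ Finset.Icc 1 4) (hb : b ∈ Finset.Icc 1 4)
    (hc : c ∈ Finset.Icc 1 4) (he : e ∈ Finset.Icc 1 4) (hab : a ≠ b) (hac : a ≠ c) (hae : a ≠ e)
    (hbc : b ≠ c) (hbe : b ≠ e) (hce : c ≠ e) :
    ∃ φ : Fin 4 ≃ Finset.Icc 1 4, ∀ j, (φ j : ℕ) = ![a, b, c, e] j := by
  have hmem : ∀ j, ![a, b, c, e] j ∈ Finset.Icc 1 4 := by
    intro j; fin_cases j <;> assumption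
  have hinj : Function.Injective fun j => (⟨![a, b, c, e] j, hmem j⟩ : Finset.Icc 1 4) := by
    intro i j hij
    have hij' : ![a, b, c, e] i = ![a, b, c, e] j := congrArg Subtype.val hij
    fin_cases i <;> fin_cases j <;> simp_all
  exact ⟨Equiv.ofBijective _ ((Fintype.bijective_iff_injective_and_card _).2 ⟨hinj, by simp⟩),
    fun j => rfl⟩

/-- Minimality of a system of generators, in terms of exponents. -/
theorem eq_single_of_weight_eq {s : Finset ℕ} {d : ℕ → ℕ} (hpos : ∀ i ∈ s, 0 < d i)
    (hmin : ∀ i ∈ s, d i ∉ AddSubmonoid.closure (d '' (s.erase i : Finset ℕ))) (i : s)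
    (u : s →₀ ℕ) (hu : Finsupp.weight (fun i : s => d i) u = d i) : u = Finsupp.single i 1 := by
  have hpos' : ∀ i : s, 0 < d i := fun i => hpos i i.2
  by_cases hi : u i = 0
  · exfalso
    apply hmin i i.2
    rw [← hu, Finsupp.weight_apply, Finsupp.sum]
    refine sum_mem fun j hj => ?_
    refine AddSubmonoid.nsmul_mem _ (AddSubmonoid.subset_closure (Set.mem_image_of_mem d ?_)) _
    have hji : j ≠ i := by
      rintro rfl
      exact (Finsupp.mem_support_iff.1 hj) hi
    simpa using fun h => hji (Subtype.ext h)
  · have hle : Finsupp.single i 1 ≤ u := by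
      rw [Finsupp.single_le_iff]; omega
    have h1 := add_tsub_cancel_of_le hle
    rw [← h1, map_add, Finsupp.weight_single, one_smul] at hu
    have h2 := weight_eq_zero (w := fun i : s => d i) hpos' (by simpa using hu)
    rw [h2, add_zero] at h1
    exact h1.symm

theorem isCompleteIntersection_of_gluing_last (k : Type*) [Field k] {d : ℕ → ℕ}
    (hpos : ∀ i ∈ Finset.Icc 1 4, 0 < d i) (hgcd : (Finset.Icc 1 4).gcd d = 1) {h : ℕ}
    (hrel : 2 * d 2 = h * d 1 + d 3) (heven : Even (d 1 / Nat.gcd (d 1) (d 2)))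
    (hmem : Nat.gcd (d 1) (d 2) * d 4 ∈ AddSubmonoid.closure ({d 1, d 2, d 3} : Set ℕ)) :
    IsCompleteIntersection (toricIdeal k (fun i : Finset.Icc 1 4 => d i)) := by
  have hd1 : 0 < d 1 := hpos 1 (by simp)
  obtain ⟨x, y, z, hxyz⟩ := mem_closure_triple_iff.1 hmem
  obtain ⟨φ, hφ⟩ := exists_equiv_Icc (a := 4) (b := 2) (c := 1) (e := 3) (by simp) (by simp)
    (by simp) (by simp) (by simp) (by simp) (by simp) (by simp) (by simp) (by simp)
  have hg : 0 < Nat.gcd (d 1) (d 2) := Nat.gcd_pos_of_pos_left _ hd1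
  obtain ⟨s, t, hcop, hs, ht⟩ := Nat.exists_coprime (d 1) (d 2)
  -- The gcd of d 1 and d 2 also divides d 3 by `hrel`, so a common divisor with d 4 divides all
  -- four.
  have hg4 : Nat.Coprime (Nat.gcd (d 1) (d 2)) (d 4) := by
    refine Nat.dvd_one.1 (dvd_trans (Finset.dvd_gcd fun i hi => ?_) hgcd.dvd)
    have hdvd := Nat.gcd_dvd_left (Nat.gcd (d 1) (d 2)) (d 4)
    have h1 := hdvd.trans (Nat.gcd_dvd_left _ _)
    have h2 := hdvd.trans (Nat.gcd_dvd_right _ _)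
    have h4 := Nat.gcd_dvd_right (Nat.gcd (d 1) (d 2)) (d 4)
    have h3 := (Nat.dvd_add_right (h1.mul_left h)).1 (hrel ▸ h2.mul_left 2)
    rw [Finset.mem_Icc] at hi
    obtain ⟨hi1, hi4⟩ := hi
    interval_cases i <;> assumption
  generalize Nat.gcd (d 1) (d 2) = g at *
  rw [hs, Nat.mul_div_cancel _ hg] at heven
  obtain ⟨s', hs'⟩ := heven
  have htodd : Nat.Coprime 2 t := hcop.coprime_dvd_left ⟨s', by omega⟩
  refine isCompleteIntersection_of_gluing (fun i => hpos i i.2) φ (d := ![d 4, d 2, d 1, d 3])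
    (fun j => ?_) (c₀ := g) (p₁ := y) (p₂ := x) (p₃ := z) hg ?_ ?_ (c₁ := 2) (q₂ := h) (q₃ := 1)
    two_pos ?_ ?_
  · rw [hφ]; fin_cases j <;> rfl
  · simp; linarith
  · intro a x y z hxyz
    simp at hxyz
    have hrel' : (2 * d 2 : ℤ) = h * d 1 + d 3 := by exact_mod_cast hrel
    have h3 : (d 3 : ℤ) = g * (2 * t - h * s) := by
      rw [ht, hs] at hrel'
      push_cast at hrel'
      linear_combination -hrel'
    refine IsCoprime.dvd_of_dvd_mul_right (Nat.isCoprime_iff_coprime.2 hg4) ?_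
    rw [hxyz, h3, ht, hs]
    exact ⟨x * t + y * s + z * (2 * t - h * s), by push_cast; ring⟩
  · simp [hrel]
  · intro a x y hxy
    simp at hxy
    have hrel' : (2 * d 2 : ℤ) = h * d 1 + d 3 := by exact_mod_cast hrel
    refine IsCoprime.dvd_of_dvd_mul_right (Nat.isCoprime_iff_coprime.2 htodd) ?_
    have hgz : (g : ℤ) ≠ 0 := by exact_mod_cast hg.ne'
    -- After division by g one has d 1 = 2 s' and d 3 = 2 (t - h s'), so a * t is even while t is
    -- odd.
    refine ⟨x * s' + y * (t - h * s'), mul_left_cancel₀ hgz ?_⟩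
    rw [ht, hs, hs'] at hrel'
    rw [ht, hs, hs'] at hxy
    push_cast at hrel' hxy ⊢
    linear_combination hxy - y * hrel'

theorem isCompleteIntersection_of_reduction (k : Type*) [Field k] {d : ℕ → ℕ}
    (hpos : ∀ i ∈ Finset.Icc 1 4, 0 < d i) (hgcd : (Finset.Icc 1 4).gcd d = 1) {h : ℕ}
    (hrel : 2 * d 2 = h * d 1 + d 3) (h13 : d 1 ≠ d 3) (h14 : d 1 ≠ d 4) (h34 : d 3 ≠ d 4)
    (h1 : Even (d 1)) (h4 : Even (d 4)) (hred : IsReduction {d 1, d 3, d 4} ∅) :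
    IsCompleteIntersection (toricIdeal k (fun i : Finset.Icc 1 4 => d i)) := by
  have h3 : Even (d 3) := by
    have h5 : Even (h * d 1 + d 3) := hrel ▸ even_two_mul _
    exact (Nat.even_add.1 h5).1 (h1.mul_left h)
  -- The other three generators are even, so d 2 must be odd; this makes 2 its least multiplier.
  have h2 : Nat.Coprime 2 (d 2) := by
    rw [Nat.coprime_two_left, ← Nat.not_even_iff_odd]
    intro h2
    have h5 : 2 ∣ (Finset.Icc 1 4).gcd d := Finset.dvd_gcd fun i hi => by
      rw [Finset.mem_Icc] at hi
      obtain ⟨hi1, hi4⟩ := hi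
      interval_cases i <;> exact Even.two_dvd ‹_›
    rw [hgcd] at h5
    omega
  obtain ⟨p, q, r, c, x, y, hset, hpq, hpr, hqr, hc, hcomb, hdvd⟩ :=
    exists_of_reflTransGen_redStep_empty hred.1 (by
      intro b hb
      simp only [Finset.mem_insert, Finset.mem_singleton] at hb
      rcases hb with rfl | rfl | rfl <;> exact hpos _ (by simp)) h13 h14 h34 rfl
  have hindex : ∀ b ∈ ({p, q, r} : Finset ℕ), ∃ i ∈ Finset.Icc 1 4, i ≠ 2 ∧ b = d i ∧ Even b := by
    intro b hb
    rw [hset] at hb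
    simp only [Finset.mem_insert, Finset.mem_singleton] at hb
    rcases hb with rfl | rfl | rfl
    · exact ⟨1, by simp, by simp, rfl, h1⟩
    · exact ⟨3, by simp, by simp, rfl, h3⟩
    · exact ⟨4, by simp, by simp, rfl, h4⟩
  have hset' : ({d 1, d 3, d 4} : Set ℕ) = {p, q, r} := by
    have := congrArg (fun s : Finset ℕ => (s : Set ℕ)) hset.symm
    simpa using this
  have hmem : 2 * d 2 ∈ AddSubmonoid.closure ({p, q, r} : Set ℕ) := by
    rw [← hset', hrel, mem_closure_triple_iff]
    exact ⟨h, 1, 0, by ring⟩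
  -- The reduction does not tell which element is glued first, so the relation for 2 * d 2 is
  -- rewritten in the unknown order p, q, r.
  obtain ⟨x₀, y₀, z₀, h₀⟩ := mem_closure_triple_iff.1 hmem
  obtain ⟨i, hi, hi2, hpi, hpe⟩ := hindex p (by simp)
  obtain ⟨j, hj, hj2, hqj, hqe⟩ := hindex q (by simp)
  obtain ⟨l, hl, hl2, hrl, hre⟩ := hindex r (by simp)
  obtain ⟨φ, hφ⟩ := exists_equiv_Icc (a := 2) (by simp) hi hj hl hi2.symm hj2.symm hl2.symm
    (fun h => hpq (by rw [hpi, hqj, h])) (fun h => hpr (by rw [hpi, hrl, h]))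
    (fun h => hqr (by rw [hqj, hrl, h]))
  refine isCompleteIntersection_of_gluing (fun i => hpos i i.2) φ (d := ![d 2, p, q, r])
    (fun j => ?_) (c₀ := 2) (p₁ := x₀) (p₂ := y₀) (p₃ := z₀) two_pos (by simpa using h₀) ?_
    (c₁ := c) (q₂ := x) (q₃ := y) hc (by simpa using hcomb) (by simpa using hdvd)
  · rw [hφ]; fin_cases j
    · rfl
    · exact hpi.symm
    · exact hqj.symm
    · exact hrl.symm
  · intro a x y z hxyz
    simp at hxyz
    refine IsCoprime.dvd_of_dvd_mul_right (Nat.isCoprime_iff_coprime.2 h2) ?_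
    rw [hxyz]
    have key : ∀ b : ℕ, Even b → ((2 : ℕ) : ℤ) ∣ b := fun b hb =>
      Int.natCast_dvd_natCast.2 hb.two_dvd
    exact dvd_add (dvd_add ((key p hpe).mul_left _) ((key q hqe).mul_left _))
      ((key r hre).mul_left _)

theorem mainTheorem2 (k : Type*) [Field k] (n : ℕ) (hn : 4 ≤ n) (d : ℕ → ℕ)
    (hpos : ∀ i ∈ Finset.Icc 1 n, 0 < d i)
    (hgcd : (Finset.Icc 1 n).gcd d = 1)
    (hmin : ∀ i ∈ Finset.Icc 1 n,
      d i ∉ AddSubmonoid.closure (d '' ((Finset.Icc 1 n).erase i : Finset ℕ)))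
    (hgas : IsGenArithSeq d (n - 1)) :
    IsCompleteIntersection (toricIdeal k (fun i : Finset.Icc 1 n => d i)) ↔
      n = 4 ∧
        ((Even (d 1 / Nat.gcd (d 1) (d 2)) ∧
            Nat.gcd (d 1) (d 2) * d 4 ∈ AddSubmonoid.closure ({d 1, d 2, d 3} : Set ℕ)) ∨
          (Even (d 1) ∧ Even (d 4) ∧ IsReduction {d 1, d 3, d 4} ∅)) := by
  obtain ⟨h, e, hh, he, hseq⟩ := hgas
  have hw : ∀ i : Finset.Icc 1 n, 0 < d i := fun i => hpos i i.2
  have hmin' := eq_single_of_weight_eq hpos hmin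
  have hinj : ∀ i j : Finset.Icc 1 n, d i = d j → i = j := fun i j hij => by
    have := hmin' j (Finsupp.single i 1) (by rw [Finsupp.weight_single, one_smul, hij])
    exact (Finsupp.single_left_inj one_ne_zero).1 this
  have h2 : d 2 = h * d 1 + e := by simpa using hseq 2 (by rw [Finset.mem_Icc]; omega)
  have h3 : d 3 = h * d 1 + 2 * e := by simpa using hseq 3 (by rw [Finset.mem_Icc]; omega)
  have hrel : 2 * d 2 = h * d 1 + d 3 := by rw [h2, h3]; ring
  have hn4 : IsCompleteIntersection (toricIdeal k (fun i : Finset.Icc 1 n => d i)) → n = 4 := by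
    intro hCI
    by_contra hne
    -- For n ≥ 5 the arithmetic sequence reaches index 4, which is at most n - 1.
    have h4 : d 4 = h * d 1 + 3 * e := by simpa using hseq 4 (by rw [Finset.mem_Icc]; omega)
    let a : Fin 4 ↪ Finset.Icc 1 n :=
      ⟨fun j => ⟨j + 1, by rw [Finset.mem_Icc]; omega⟩, fun i j hij => by
        have := congrArg Subtype.val hij
        simp only at this
        omega⟩
    exact not_isCompleteIntersection_of_four_arith hw hmin' a h2 h3 h4 hCI
  by_cases hn' : n = 4
  swap
  · exact ⟨fun hCI => absurd (hn4 hCI) hn', fun hc => absurd hc.1 hn'⟩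
  subst hn'
  have hne : ∀ {i j : ℕ}, i ∈ Finset.Icc 1 4 → j ∈ Finset.Icc 1 4 → i ≠ j → d i ≠ d j :=
    fun hi hj hij hd => hij (congrArg Subtype.val (hinj ⟨_, hi⟩ ⟨_, hj⟩ hd))
  constructor
  · intro hCI
    refine ⟨rfl, ?_⟩
    obtain ⟨φ, hφ⟩ := exists_equiv_Icc (a := 1) (b := 2) (c := 3) (e := 4) (by simp) (by simp)
      (by simp) (by simp) (by simp) (by simp) (by simp) (by simp) (by simp) (by simp)
    have hd : ∀ j, d (φ j) = ![d 1, d 2, d 3, d 4] j := fun j => by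
      rw [hφ]; fin_cases j <;> rfl
    obtain ⟨u, v, u', v', H⟩ := exists_isMixedDominating hw hmin' φ hd hh (by simpa using hrel) hCI
    exact H.gluing (fun j => hd j ▸ hw (φ j))
      (fun i j hij => φ.injective (hinj _ _ (by rw [hd, hd, hij])))
  · rintro ⟨-, ⟨heven, hmem⟩ | ⟨he1, he4, hred⟩⟩
    · exact isCompleteIntersection_of_gluing_last k hpos hgcd hrel heven hmem
    · exact isCompleteIntersection_of_reduction k hpos hgcd hrel
        (hne (by simp) (by simp) (by simp)) (hne (by simp) (by simp) (by simp))
        (hne (by simp) (by simp) (by simp)) he1 he4 hred
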